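/- Let $(X,\langle\cdot|\cdot\rangle)$ be a non-trivial complex Hilbert space with norm $\|\cdot\|$, and let $A:D(A)\to X$ be a densely defined self-adjoint linear operator in $X$ such that, for some $\varepsilon>0$, $\langle\xi|A\xi\rangle\ge\varepsilon\langle\xi|\xi\rangle$ for all $\xi\in D(A)$. Let $A^{1/2}:D(A^{1/2})\to X$ be the positive self-adjoint square root of $A$. Let $B,C:D(A^{1/2})\to X$ be linear, and suppose that there are $a\in[0,1)$ and $b,c,d\in\mathbb R$ with $$\|B\xi\|^2\le a^2\|A^{1/2}\xi\|^2+b^2\|\xi\|^2,\qquad \|C\xi\|^2\le c^2\|A^{1/2}\xi\|^2+d^2\|\xi\|^2\qquad(\xi\in D(A^{1/2})).$$ Suppose in addition that $B$ is symmetric or bounded (with respect to $\|\cdot\|$). Let $Y:=D(A^{1/2})\times X$ with the inner product $(\xi|\eta):=\langle A^{1/2}\xi_1|A^{1/2}\eta_1\rangle+\langle\xi_2|\eta_2\rangle$, and define the operators in $Y$ $$H\xi:=(-i\xi_2,\,iA\xi_1),\quad \hat B\xi:=(0,-B\xi_2)\quad(\xi\in D(H):=D(A)\times D(A^{1/2})),\qquad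 V\xi:=(0,\,iC\xi_1)\quad(\xi\in Y),$$ $$G_+:=-i(H+\hat B+V),\qquad G_-:=i(H+\hat B+V),\qquad D(G_\pm)=D(H).$$ Call an operator $G$ in $Y$ the infinitesimal generator of a strongly continuous semigroup $T:[0,\infty)\to L(Y,Y)$ if $D(G)$ is the set of all $\xi\in Y$ for which $\lim_{t\downarrow0}t^{-1}(\xi-T(t)\xi)$ exists and $G\xi$ is that limit for all $\xi\in D(G)$ (formally, $T(t)=e^{-tG}$). Then the following hold. (i) $G_+$ and $G_-$ are infinitesimal generators of strongly continuous semigroups $T_+$ and $T_-$ of bounded linear operators on $Y$, respectively, and for any such $T_+$, $T_-$, setting $T(t):=T_+(t)$ for $t\ge0$ and $T(t):=T_-(-t)$ for $t<0$ defines a strongly continuous group $T:\mathbb R\to L(Y,Y)$. (ii) For every $t_0\in\mathbb R$ and every $\xi\in D(G_+)$ there is a uniquely determined differentiable map $u:\mathbb R\to Y$, with $u(t)\in D(G_+)$ for all $t$, such that $u(t_0)=\xi$ and $u'(t)=-G_+u(t)$ for all $t\in\mathbb R$ (the derivative being taken in the norm of $Y$). (iii) For the map $u$ of (ii), the function $(u|u):\mathbb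 R\to\mathbb R$, $t\mapsto(u(t)|u(t))$, is differentiable and $(u|u)'(t)=-2\,\mathrm{Re}\,(u(t)|G_+u(t))$ for all $t\in\mathbb R$. -/

import Mathlib

open scoped NNReal

noncomputable section

namespace AbstractWave

/-! ### Strongly continuous semigroups and groups, generators, evolution equations -/

section Semigroups

variable {E : Type*} [NormedAddCommGroup E] [NormedSpace ℂ E]

/-- A strongly continuous semigroup `T : [0, ∞) → L(E, E)`. -/
structure IsSCSemigroup (T : ℝ≥0 → E →L[ℂ] E) : Prop where
  map_zero : T 0 = ContinuousLinearMap.id ℂ E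
  map_add : ∀ s t : ℝ≥0, T (s + t) = (T s).comp (T t)
  continuous_orbit : ∀ x : E, Continuous fun t : ℝ≥0 => T t x

/-- A strongly continuous group `T : ℝ → L(E, E)`. -/
structure IsSCGroup (T : ℝ → E →L[ℂ] E) : Prop where
  map_zero : T 0 = ContinuousLinearMap.id ℂ E
  map_add : ∀ s t : ℝ, T (s + t) = (T s).comp (T t)
  continuous_orbit : ∀ x : E, Continuous fun t : ℝ => T t x

/-- `G` is the infinitesimal generator of `T`, in the sign convention `T(t) = exp(-t G)`:
`D(G)` is the set of all `x` for which `t⁻¹ (x - T(t) x)` has a limit as `t ↓ 0`, and `G x` is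
that limit. -/
def IsGenerator (G : E →ₗ.[ℂ] E) (T : ℝ≥0 → E →L[ℂ] E) : Prop :=
  ∀ x y : E, (x, y) ∈ G.graph ↔
    Filter.Tendsto (fun t : ℝ≥0 => (t : ℝ)⁻¹ • (x - T t x)) (nhdsWithin 0 (Set.Ioi 0)) (nhds y)

/-- `T` is a strongly continuous semigroup with infinitesimal generator `G`. -/
def Generates (G : E →ₗ.[ℂ] E) (T : ℝ≥0 → E →L[ℂ] E) : Prop :=
  IsSCSemigroup T ∧ IsGenerator G T

/-- The map `ℝ → L(E, E)` given by `Tp(t)` for `t ≥ 0` and by `Tm(-t)` for `t < 0`. -/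
def glue (Tp Tm : ℝ≥0 → E →L[ℂ] E) (t : ℝ) : E →L[ℂ] E :=
  if 0 ≤ t then Tp t.toNNReal else Tm (-t).toNNReal

/-- `u : ℝ → E` is differentiable, takes its values in `D(G)`, and `u'(t) = -G u(t)` for
all `t`. -/
def IsSolution (G : E →ₗ.[ℂ] E) (u : ℝ → E) : Prop :=
  ∀ t : ℝ, ∃ h : u t ∈ G.domain, HasDerivAt u (-(G ⟨u t, h⟩)) t

end Semigroups

/-! ### Strictly positive self-adjoint operators and their square roots -/

variable {X : Type*} [NormedAddCommGroup X] [InnerProductSpace ℂ X] [CompleteSpace X]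

/-- `A` is a self-adjoint (in particular densely defined) linear operator in `X`, and
`⟨ξ, A ξ⟩ ≥ ε ⟨ξ, ξ⟩` on `D(A)` for some `ε > 0`. -/
structure IsStrictlyPositiveSA (A : X →ₗ.[ℂ] X) : Prop where
  isSelfAdjoint : IsSelfAdjoint A
  lower_bound : ∃ ε : ℝ, 0 < ε ∧ ∀ ξ : A.domain,
    ε * (inner ℂ (ξ : X) (ξ : X)).re ≤ (inner ℂ (ξ : X) (A ξ)).re

/-- `S` is a positive self-adjoint operator with `S ∘ S = A`, domains included. -/
structure IsPositiveSqrt (S A : X →ₗ.[ℂ] X) : Prop where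
  isSelfAdjoint : IsSelfAdjoint S
  nonneg : ∀ ξ : S.domain, 0 ≤ (inner ℂ (ξ : X) (S ξ)).re
  sq_eq : ∀ x y : X, (x, y) ∈ A.graph ↔ ∃ z : X, (x, z) ∈ S.graph ∧ (z, y) ∈ S.graph

theorem inner_graph_symm {T : X →ₗ.[ℂ] X} (hT : IsSelfAdjoint T) {x x' y y' : X}
    (hx : (x, x') ∈ T.graph) (hy : (y, y') ∈ T.graph) : inner ℂ x' y = inner ℂ x y' := by
  have hs : T.IsFormalAdjoint T := by
    have := LinearPMap.adjoint_isFormalAdjoint hT.dense_domain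
    rwa [LinearPMap.isSelfAdjoint_def.mp hT] at this
  obtain ⟨a, rfl, rfl⟩ := (LinearPMap.mem_graph_iff _).mp hx
  obtain ⟨b, rfl, rfl⟩ := (LinearPMap.mem_graph_iff _).mp hy
  exact hs a b

theorem mem_graph_of_forall {T : X →ₗ.[ℂ] X} (hT : IsSelfAdjoint T) {y w : X}
    (h : ∀ x : T.domain, inner ℂ w (x : X) = inner ℂ y (T x)) : (y, w) ∈ T.graph := by
  have hd : y ∈ T.adjoint.domain := LinearPMap.mem_adjoint_domain_of_exists y ⟨w, h⟩
  have he := LinearPMap.adjoint_apply_eq hT.dense_domain ⟨y, hd⟩ h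
  have hg := LinearPMap.mem_graph T.adjoint ⟨y, hd⟩
  rw [he] at hg
  exact (LinearPMap.isSelfAdjoint_def.mp hT) ▸ hg

theorem exists_inverse {T : X →ₗ.[ℂ] X} (hT : IsSelfAdjoint T)
    (hinj : ∀ x, (x, (0 : X)) ∈ T.graph → x = 0) (hsurj : ∀ y, ∃ x, (x, y) ∈ T.graph) :
    ∃ R : X →L[ℂ] X, (∀ x y, inner ℂ (R x) y = inner ℂ x (R y)) ∧
      ∀ x y, (x, y) ∈ T.graph ↔ x = R y := by
  choose r hr using hsurj
  have huniq : ∀ x y, (x, y) ∈ T.graph → x = r y := fun x y h => by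
    have := T.graph.sub_mem h (hr y)
    simp only [Prod.mk_sub_mk, sub_self] at this
    exact sub_eq_zero.mp (hinj _ this)
  let R₀ : X →ₗ[ℂ] X :=
    { toFun := r
      map_add' := fun x y => (huniq _ _ (T.graph.add_mem (hr x) (hr y))).symm
      map_smul' := fun c x => (huniq _ _ (T.graph.smul_mem c (hr x))).symm }
  have hsym : R₀.IsSymmetric := fun x y => (inner_graph_symm hT (hr x) (hr y)).symm
  refine ⟨⟨R₀, hsym.continuous⟩, fun x y => hsym x y, fun x y => ⟨huniq x y, ?_⟩⟩
  rintro rfl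
  exact hr y

theorem exists_of_inverse (R : X →L[ℂ] X) (hR : ∀ x y, inner ℂ (R x) y = inner ℂ x (R y))
    (hinj : ∀ x, R x = 0 → x = 0) :
    ∃ T : X →ₗ.[ℂ] X, IsSelfAdjoint T ∧ ∀ x y, (x, y) ∈ T.graph ↔ x = R y := by
  let g : Submodule ℂ (X × X) := LinearMap.range ((R : X →ₗ[ℂ] X).prod LinearMap.id)
  have hg : ∀ x y, (x, y) ∈ g ↔ x = R y := fun x y => by
    constructor
    · rintro ⟨z, hz⟩
      simp only [LinearMap.prod_apply, Function.prod_apply, Prod.mk.injEq, LinearMap.id_apply] at hz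
      obtain ⟨h1, rfl⟩ := hz
      exact h1.symm
    · rintro rfl
      exact ⟨y, rfl⟩
  have hgr : g.toLinearPMap.graph = g := by
    refine Submodule.toLinearPMap_graph_eq _ ?_
    rintro ⟨x, y⟩ hxy (rfl : x = 0)
    exact hinj _ ((hg _ _).mp hxy).symm
  refine ⟨g.toLinearPMap, ?_, fun x y => by rw [hgr, hg]⟩
  set T := g.toLinearPMap
  have hT : ∀ x y, (x, y) ∈ T.graph ↔ x = R y := fun x y => by rw [hgr, hg]
  have hmem : ∀ y, ∃ x : T.domain, (x : X) = R y ∧ T x = y := fun y =>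
    (LinearPMap.mem_graph_iff _).mp ((hT (R y) y).mpr rfl)
  have happ : ∀ x : T.domain, (x : X) = R (T x) := fun x => (hT _ _).mp (T.mem_graph x)
  have hdense : Dense (T.domain : Set X) := by
    rw [Submodule.dense_iff_topologicalClosure_eq_top,
      Submodule.topologicalClosure_eq_top_iff, Submodule.eq_bot_iff]
    intro x hx
    refine hinj x (ext_inner_left ℂ fun y => ?_)
    obtain ⟨z, hz, -⟩ := hmem y
    rw [inner_zero_right, ← hR, ← hz]
    exact (Submodule.mem_orthogonal _ _).mp hx z z.2
  have hform : T.IsFormalAdjoint T := fun x y => by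
    conv_lhs => rw [happ y]
    conv_rhs => rw [happ x]
    exact (hR _ _).symm
  refine LinearPMap.isSelfAdjoint_def.mpr (le_antisymm ?_ (hform.le_adjoint hdense))
  refine LinearPMap.le_of_le_graph ?_
  rintro ⟨y, w⟩ hyw
  obtain ⟨a, rfl, rfl⟩ := (LinearPMap.mem_graph_iff _).mp hyw
  refine (hT _ _).mpr (ext_inner_right ℂ fun v => ?_)
  obtain ⟨z, hz, hz'⟩ := hmem v
  have := LinearPMap.adjoint_isFormalAdjoint hdense a z
  rw [hz, hz'] at this
  rw [hR]
  exact this.symm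

section Sqrt

variable {A : X →ₗ.[ℂ] X}

theorem IsStrictlyPositiveSA.exists_bound (hA : IsStrictlyPositiveSA A) :
    ∃ ε : ℝ, 0 < ε ∧ ∀ x y, (x, y) ∈ A.graph → ε * ‖x‖ ^ 2 ≤ (inner ℂ x y).re := by
  obtain ⟨ε, hε, h⟩ := hA.lower_bound
  refine ⟨ε, hε, fun x y hxy => ?_⟩
  obtain ⟨a, rfl, rfl⟩ := (LinearPMap.mem_graph_iff _).mp hxy
  have h1 := h a
  have h2 := inner_self_eq_norm_sq (𝕜 := ℂ) (a : X)
  simp only [RCLike.re_eq_complex_re] at h2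
  rwa [h2] at h1

theorem IsStrictlyPositiveSA.exists_inverse (hA : IsStrictlyPositiveSA A) :
    ∃ R : X →L[ℂ] X, 0 ≤ R ∧ ∀ x y, (x, y) ∈ A.graph ↔ x = R y := by
  obtain ⟨ε, hε, hb⟩ := hA.exists_bound
  have hnorm : ∀ x y, (x, y) ∈ A.graph → ε * ‖x‖ ≤ ‖y‖ := fun x y hxy => by
    rcases (norm_nonneg x).eq_or_lt with h0 | h0
    · rw [← h0]; simp
    · have h1 := hb x y hxy
      have h2 : (inner ℂ x y).re ≤ ‖x‖ * ‖y‖ := re_inner_le_norm (𝕜 := ℂ) x y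
      nlinarith
  have hinj : ∀ x, (x, (0 : X)) ∈ A.graph → x = 0 := fun x hx => by
    have := hnorm x 0 hx
    rw [norm_zero] at this
    exact norm_le_zero_iff.mp (by nlinarith [norm_nonneg x])
  have hclosed : IsClosed (A.graph : Set (X × X)) := hA.isSelfAdjoint.isClosed
  let f : A.graph →L[ℂ] X := (ContinuousLinearMap.snd ℂ X X).comp A.graph.subtypeL
  have hf : AntilipschitzWith (Real.toNNReal (max 1 ε⁻¹)) f := by
    refine AddMonoidHomClass.antilipschitz_of_bound f ?_
    rintro ⟨⟨x, y⟩, hxy⟩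
    have h1 := hnorm x y hxy
    have hm : 0 ≤ max 1 ε⁻¹ := le_trans zero_le_one (le_max_left _ _)
    rw [Real.coe_toNNReal _ hm]
    change max ‖x‖ ‖y‖ ≤ _ * ‖y‖
    refine max_le ?_ ?_
    · calc ‖x‖ ≤ ε⁻¹ * ‖y‖ := by
            rw [inv_mul_eq_div, le_div_iff₀ hε]; linarith
        _ ≤ _ := by gcongr; exact le_max_right _ _
    · calc ‖y‖ = 1 * ‖y‖ := (one_mul _).symm
        _ ≤ _ := by gcongr; exact le_max_left _ _
  have : CompleteSpace A.graph := hclosed.completeSpace_coe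
  have hrange : IsClosed (Set.range f) := hf.isClosed_range f.uniformContinuous
  have hsurj : ∀ y, ∃ x, (x, y) ∈ A.graph := by
    have hcl : IsClosed ((LinearMap.range (f : A.graph →ₗ[ℂ] X) : Submodule ℂ X) : Set X) := by
      exact hrange
    have : CompleteSpace (LinearMap.range (f : A.graph →ₗ[ℂ] X)) := hcl.completeSpace_coe
    have htop : LinearMap.range (f : A.graph →ₗ[ℂ] X) = ⊤ := by
      rw [← Submodule.orthogonal_eq_bot_iff, Submodule.eq_bot_iff]
      intro w hw
      refine hinj w (mem_graph_of_forall hA.isSelfAdjoint fun x => ?_)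
      rw [inner_zero_left]
      exact ((Submodule.mem_orthogonal' _ _).mp hw _
        ⟨⟨((x : X), A x), A.mem_graph x⟩, rfl⟩).symm
    intro y
    obtain ⟨⟨⟨x, y'⟩, hxy⟩, rfl⟩ : y ∈ LinearMap.range (f : A.graph →ₗ[ℂ] X) :=
      htop ▸ Submodule.mem_top
    exact ⟨x, hxy⟩
  obtain ⟨R, hR, hgr⟩ := AbstractWave.exists_inverse hA.isSelfAdjoint hinj hsurj
  refine ⟨R, ?_, hgr⟩
  rw [ContinuousLinearMap.nonneg_iff_isPositive, ContinuousLinearMap.isPositive_def]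
  refine ⟨hR, fun x => ?_⟩
  have := hb (R x) x ((hgr _ _).mpr rfl)
  exact le_trans (by positivity) this

/-- A strictly positive self-adjoint operator has exactly one positive self-adjoint square
root. -/
theorem IsStrictlyPositiveSA.existsUnique_sqrt (hA : IsStrictlyPositiveSA A) :
    ∃! S : X →ₗ.[ℂ] X, IsPositiveSqrt S A := by
  obtain ⟨R, hR0, hR⟩ := hA.exists_inverse
  have hRinj : ∀ x, R x = 0 → x = 0 := fun x hx => by
    have h1 : ((0 : X), x) ∈ A.graph := (hR _ _).mpr hx.symm
    exact LinearPMap.graph_fst_eq_zero_snd A h1 rfl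
  set Q : X →L[ℂ] X := CFC.sqrt R with hQ
  have hQ0 : 0 ≤ Q := CFC.sqrt_nonneg R
  have hQQ : ∀ x, Q (Q x) = R x := fun x => by
    have : Q * Q = R := CFC.sqrt_mul_sqrt_self R hR0
    rw [← this]; rfl
  have hQpos := ContinuousLinearMap.nonneg_iff_isPositive Q |>.mp hQ0
  obtain ⟨hQsym, hQre⟩ := ContinuousLinearMap.isPositive_def.mp hQpos
  obtain ⟨S, hS, hSgr⟩ := exists_of_inverse Q hQsym
    (fun x hx => hRinj x (by rw [← hQQ, hx, map_zero]))
  refine ⟨S, ⟨hS, fun ξ => ?_, fun x y => ?_⟩, fun S' hS' => ?_⟩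
  · have h1 : (ξ : X) = Q (S ξ) := (hSgr _ _).mp (S.mem_graph ξ)
    rw [h1]
    exact hQre (S ξ)
  · simp only [hSgr, hR, ← hQQ]
    exact ⟨fun h => ⟨Q y, h, rfl⟩, by rintro ⟨z, h, rfl⟩; exact h⟩
  · have hinj' : ∀ x, (x, (0 : X)) ∈ S'.graph → x = 0 := fun x hx => by
      have : (x, (0 : X)) ∈ A.graph := (hS'.sq_eq _ _).mpr ⟨0, hx, S'.graph.zero_mem⟩
      rw [(hR _ _).mp this, map_zero]
    have hsurj' : ∀ y, ∃ x, (x, y) ∈ S'.graph := fun y => by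
      obtain ⟨z, -, hz⟩ := (hS'.sq_eq (R y) y).mp ((hR _ _).mpr rfl)
      exact ⟨z, hz⟩
    obtain ⟨P, hP, hPgr⟩ := AbstractWave.exists_inverse hS'.isSelfAdjoint hinj' hsurj'
    have hP0 : 0 ≤ P := by
      rw [ContinuousLinearMap.nonneg_iff_isPositive, ContinuousLinearMap.isPositive_def]
      refine ⟨hP, fun x => ?_⟩
      obtain ⟨a, ha, ha'⟩ := (LinearPMap.mem_graph_iff _).mp ((hPgr (P x) x).mpr rfl)
      have := hS'.nonneg a
      rwa [ha, ha'] at this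
    have hPP : P * P = R := by
      ext y
      exact (hR _ _).mp ((hS'.sq_eq _ _).mpr ⟨P y, (hPgr _ _).mpr rfl, (hPgr _ _).mpr rfl⟩)
    have hPQ : P = Q := (CFC.sqrt_unique hPP hP0).symm
    refine LinearPMap.eq_of_eq_graph ?_
    ext ⟨x, y⟩
    rw [hPgr, hSgr, hPQ]

/-- The positive self-adjoint square root `A^{1/2}`. -/
def sqrtOp (hA : IsStrictlyPositiveSA A) : X →ₗ.[ℂ] X :=
  hA.existsUnique_sqrt.choose

theorem sqrtOp_spec (hA : IsStrictlyPositiveSA A) : IsPositiveSqrt (sqrtOp hA) A :=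
  hA.existsUnique_sqrt.choose_spec.1

theorem sqrtOp_injective (hA : IsStrictlyPositiveSA A) (ξ : (sqrtOp hA).domain)
    (h : sqrtOp hA ξ = 0) : ξ = 0 := by
  obtain ⟨R, -, hR⟩ := hA.exists_inverse
  have h1 := (sqrtOp hA).mem_graph ξ
  rw [h] at h1
  have h2 := (hR _ _).mp (((sqrtOp_spec hA).sq_eq _ _).mpr ⟨0, h1, (sqrtOp hA).graph.zero_mem⟩)
  rw [map_zero] at h2
  exact Subtype.ext h2

theorem mem_sqrtOp_domain (hA : IsStrictlyPositiveSA A) {x : X} (hx : x ∈ A.domain) :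
    x ∈ (sqrtOp hA).domain := by
  obtain ⟨z, hz, -⟩ := ((sqrtOp_spec hA).sq_eq _ _).mp (A.mem_graph ⟨x, hx⟩)
  exact LinearPMap.mem_domain_of_mem_graph hz

end Sqrt

/-! ### The space `Y = D(A^{1/2}) × X` -/

variable {A : X →ₗ.[ℂ] X}

/-- The set `Y = D(A^{1/2}) × X`. Its norm is the one of the inner product below. -/
def EnergySpace (hA : IsStrictlyPositiveSA A) : Type _ := (sqrtOp hA).domain × X

namespace EnergySpace

variable (hA : IsStrictlyPositiveSA A)

instance instAddCommGroup : AddCommGroup (EnergySpace hA) :=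
  inferInstanceAs (AddCommGroup ((sqrtOp hA).domain × X))

instance instModule : Module ℂ (EnergySpace hA) :=
  inferInstanceAs (Module ℂ ((sqrtOp hA).domain × X))

variable {hA}

/-- The first component `ξ₁ ∈ D(A^{1/2})`. -/
def fst : EnergySpace hA →ₗ[ℂ] (sqrtOp hA).domain := LinearMap.fst ℂ (sqrtOp hA).domain X

/-- The second component `ξ₂ ∈ X`. -/
def snd : EnergySpace hA →ₗ[ℂ] X := LinearMap.snd ℂ (sqrtOp hA).domain X

/-- The element `(x, y)` of `Y`. -/
def mk (x : (sqrtOp hA).domain) (y : X) : EnergySpace hA := (x, y)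

@[simp] theorem fst_mk (x : (sqrtOp hA).domain) (y : X) : fst (mk x y) = x := rfl

@[simp] theorem snd_mk (x : (sqrtOp hA).domain) (y : X) : snd (mk x y) = y := rfl

@[ext] theorem ext {ξ η : EnergySpace hA} (h₁ : fst ξ = fst η) (h₂ : snd ξ = snd η) : ξ = η :=
  Prod.ext h₁ h₂

/-- The inner product `(ξ|η) = ⟨A^{1/2} ξ₁, A^{1/2} η₁⟩ + ⟨ξ₂, η₂⟩`. -/
@[reducible]
def core (hA : IsStrictlyPositiveSA A) : InnerProductSpace.Core ℂ (EnergySpace hA) where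
  inner ξ η := inner ℂ (sqrtOp hA (fst ξ)) (sqrtOp hA (fst η)) + inner ℂ (snd ξ) (snd η)
  conj_inner_symm ξ η := by simp only [map_add, inner_conj_symm]
  re_inner_nonneg ξ := by
    rw [map_add]
    exact add_nonneg inner_self_nonneg inner_self_nonneg
  add_left ξ η ζ := by
    simp only [map_add, LinearPMap.map_add, inner_add_left]
    ring
  smul_left ξ η r := by
    simp only [map_smul, LinearPMap.map_smul, inner_smul_left]
    ring
  definite ξ h := by
    have h' := congrArg Complex.re h
    have h1 : 0 ≤ (inner ℂ (sqrtOp hA (fst ξ)) (sqrtOp hA (fst ξ))).re :=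
      inner_self_nonneg (𝕜 := ℂ)
    have h2 : 0 ≤ (inner ℂ (snd ξ) (snd ξ)).re := inner_self_nonneg (𝕜 := ℂ)
    rw [Complex.add_re, Complex.zero_re] at h'
    refine EnergySpace.ext ?_ ?_
    · rw [map_zero]
      exact sqrtOp_injective hA _
        ((re_inner_self_nonpos (𝕜 := ℂ)).mp (show (inner ℂ _ _).re ≤ 0 by linarith))
    · rw [map_zero]
      exact (re_inner_self_nonpos (𝕜 := ℂ)).mp (show (inner ℂ _ _).re ≤ 0 by linarith)

instance instNormedAddCommGroup : NormedAddCommGroup (EnergySpace hA) :=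
  @InnerProductSpace.Core.toNormedAddCommGroup ℂ (EnergySpace hA) _ _ _ (core hA)

instance instInnerProductSpace : InnerProductSpace ℂ (EnergySpace hA) :=
  InnerProductSpace.ofCore (core hA).toCore

theorem inner_def (ξ η : EnergySpace hA) :
    inner ℂ ξ η =
      inner ℂ (sqrtOp hA (fst ξ)) (sqrtOp hA (fst η)) + inner ℂ (snd ξ) (snd η) := rfl

end EnergySpace

/-! ### The operators `H`, `B̂`, `V`, `G₊`, `G₋` in `Y` -/

open EnergySpace

variable (hA : IsStrictlyPositiveSA A)

/-- The subspace `D(A) × D(A^{1/2})` of `Y`. -/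
def domH : Submodule ℂ (EnergySpace hA) :=
  A.domain.comap ((sqrtOp hA).domain.subtype ∘ₗ fst) ⊓ (sqrtOp hA).domain.comap snd

/-- `(ξ₁, ξ₂) ↦ ξ₁` as a map from `D(A) × D(A^{1/2})` to `D(A)`. -/
def domFst : domH hA →ₗ[ℂ] A.domain :=
  (((sqrtOp hA).domain.subtype ∘ₗ fst) ∘ₗ (domH hA).subtype).codRestrict A.domain
    fun ξ => ξ.2.1

/-- `(ξ₁, ξ₂) ↦ ξ₂` as a map from `D(A) × D(A^{1/2})` to `D(A^{1/2})`. -/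
def domSnd : domH hA →ₗ[ℂ] (sqrtOp hA).domain :=
  (snd ∘ₗ (domH hA).subtype).codRestrict (sqrtOp hA).domain fun ξ => ξ.2.2

/-- `H ξ = (-i ξ₂, i A ξ₁)` with domain `D(A) × D(A^{1/2})`. -/
def opH : EnergySpace hA →ₗ.[ℂ] EnergySpace hA where
  domain := domH hA
  toFun :=
    { toFun := fun ξ => mk (-Complex.I • domSnd hA ξ) (Complex.I • A (domFst hA ξ))
      map_add' := fun ξ η => by
        ext1
        · rw [fst_mk, map_add, map_add, smul_add, fst_mk, fst_mk]
        · rw [snd_mk, map_add, map_add, LinearPMap.map_add, smul_add, snd_mk, snd_mk]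
      map_smul' := fun c ξ => by
        ext1
        · rw [fst_mk, map_smul, map_smul, fst_mk, smul_comm, RingHom.id_apply]
        · rw [snd_mk, map_smul, map_smul, LinearPMap.map_smul, snd_mk, smul_comm,
            RingHom.id_apply] }

/-- `B̂ ξ = (0, -B ξ₂)` with domain `D(H)`. -/
def opBhat (B : (sqrtOp hA).domain →ₗ[ℂ] X) : EnergySpace hA →ₗ.[ℂ] EnergySpace hA where
  domain := domH hA
  toFun :=
    { toFun := fun ξ => mk 0 (-B (domSnd hA ξ))
      map_add' := fun ξ η => by
        ext1
        · rw [fst_mk, map_add, fst_mk, fst_mk, add_zero]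
        · rw [snd_mk, map_add, map_add, map_add, snd_mk, snd_mk, neg_add]
      map_smul' := fun c ξ => by
        ext1
        · rw [fst_mk, map_smul, fst_mk, smul_zero]
        · rw [snd_mk, map_smul, map_smul, map_smul, snd_mk, smul_neg, RingHom.id_apply] }

/-- `V ξ = (0, i C ξ₁)` on all of `Y`. -/
def opV (C : (sqrtOp hA).domain →ₗ[ℂ] X) : EnergySpace hA →ₗ[ℂ] EnergySpace hA where
  toFun ξ := mk 0 (Complex.I • C (fst ξ))
  map_add' ξ η := by
    ext1
    · rw [fst_mk, map_add, fst_mk, fst_mk, add_zero]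
    · rw [snd_mk, map_add, map_add, map_add, snd_mk, snd_mk, smul_add]
  map_smul' c ξ := by
    ext1
    · rw [fst_mk, map_smul, fst_mk, smul_zero]
    · rw [snd_mk, map_smul, map_smul, map_smul, snd_mk, smul_comm, RingHom.id_apply]

/-- `G₊ = -i (H + B̂ + V)`, with domain `D(H)`. -/
def opGPlus (B C : (sqrtOp hA).domain →ₗ[ℂ] X) : EnergySpace hA →ₗ.[ℂ] EnergySpace hA :=
  (-Complex.I) • (opV hA C +ᵥ (opH hA + opBhat hA B))

/-- `G₋ = i (H + B̂ + V)`, with domain `D(H)`. -/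
def opGMinus (B C : (sqrtOp hA).domain →ₗ[ℂ] X) : EnergySpace hA →ₗ.[ℂ] EnergySpace hA :=
  Complex.I • (opV hA C +ᵥ (opH hA + opBhat hA B))

end AbstractWave

end

open AbstractWave

/-! Both `G₊` and `G₋ = -G₊` are quasi-`m`-accretive in the energy space `Y`, and Hille-Yosida
theory does the rest. The energy norm makes the free part `F = -iH` skew: `Re (ξ|Fξ) = 0`
(`re_inner_freeWave`). So only `B` and `C` contribute to `Re (ξ|G₊ξ)`. The `C` term is bounded on
`Y`; the `B` term is `Re ⟨ξ₂|iBξ₂⟩`, which vanishes for symmetric `B` and is bounded for bounded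
`B`. Hence `|Re (ξ|G₊ξ)| ≤ ω‖ξ‖²`. For surjectivity of `l + G₊`, skewness gives `‖lξ + Fξ‖² = l²‖ξ‖²
+ ‖Fξ‖²`. As `F` is the part measuring `‖A^{1/2}ξ₂‖`, the perturbation has bound `a + O(1/|l|)`
relative to `l + F`. This is below 1 for large `|l|` of either sign, and a Neumann series applies
(`exists_opGPlus_surjective`). Generation (`IsQuasiMAccretive.exists_generates`) comes from Yosida
approximation. Gronwall's inequality for `‖u‖²`, run forwards with `G₊` and backwards with `G₋`,
gives uniqueness (`IsSolution.eq`), and uniqueness gives the group law. -/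

namespace AbstractWave

/-! ### Energy identity and Gronwall's inequality -/

section Energy

variable {E : Type*} [NormedAddCommGroup E] [InnerProductSpace ℂ E]

theorem re_inner_self_eq_norm_sq (x : E) : (inner ℂ x x).re = ‖x‖ ^ 2 :=
  inner_self_eq_norm_sq (𝕜 := ℂ) x

theorem hasDerivAt_re_inner_self {u : ℝ → E} {u' : E} {t : ℝ} (hu : HasDerivAt u u' t) :
    HasDerivAt (fun s => (inner ℂ (u s) (u s)).re) (2 * (inner ℂ (u t) u').re) t := by
  have h := Complex.reCLM.hasFDerivAt.comp_hasDerivAt t (hu.inner ℂ hu)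
  refine h.congr_deriv ?_
  have hsymm : (inner ℂ u' (u t)).re = (inner ℂ (u t) u').re := inner_re_symm (𝕜 := ℂ) _ _
  change (inner ℂ (u t) u' + inner ℂ u' (u t)).re = _
  rw [Complex.add_re, hsymm]
  ring

/-- Gronwall's inequality for the norm in a Hilbert space. -/
theorem norm_le_exp_mul_of_re_inner_le {u u' : ℝ → E} {κ : ℝ}
    (hu : ∀ t, HasDerivAt u (u' t) t) (h : ∀ t, (inner ℂ (u t) (u' t)).re ≤ κ * ‖u t‖ ^ 2)
    {a b : ℝ} (hab : a ≤ b) : ‖u b‖ ≤ Real.exp (κ * (b - a)) * ‖u a‖ := by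
  -- The weight `exp (-2κs)` turns the differential inequality for `‖u‖²` into monotonicity.
  have hd : ∀ t, HasDerivAt (fun s => Real.exp (-(2 * κ) * s) * (inner ℂ (u s) (u s)).re)
      (Real.exp (-(2 * κ) * t) * (-(2 * κ)) * (inner ℂ (u t) (u t)).re +
        Real.exp (-(2 * κ) * t) * (2 * (inner ℂ (u t) (u' t)).re)) t := fun t => by
    have h1 : HasDerivAt (fun s => Real.exp (-(2 * κ) * s))
        (Real.exp (-(2 * κ) * t) * (-(2 * κ))) t := by
      simpa using ((hasDerivAt_id t).const_mul (-(2 * κ))).exp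
    exact h1.mul (hasDerivAt_re_inner_self (hu t))
  have hanti : Antitone fun s => Real.exp (-(2 * κ) * s) * (inner ℂ (u s) (u s)).re := by
    refine antitone_of_deriv_nonpos (fun t => (hd t).differentiableAt) fun t => ?_
    rw [(hd t).deriv, re_inner_self_eq_norm_sq]
    nlinarith [Real.exp_pos (-(2 * κ) * t), h t]
  have h1 := hanti hab
  simp only [re_inner_self_eq_norm_sq] at h1
  refine le_of_sq_le_sq ?_ (by positivity)
  rw [mul_pow, ← Real.exp_nat_mul]
  calc ‖u b‖ ^ 2 = Real.exp (2 * κ * b) * (Real.exp (-(2 * κ) * b) * ‖u b‖ ^ 2) := by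
        rw [← mul_assoc, ← Real.exp_add]; simp
    _ ≤ Real.exp (2 * κ * b) * (Real.exp (-(2 * κ) * a) * ‖u a‖ ^ 2) := by gcongr
    _ = _ := by
        rw [← mul_assoc, ← Real.exp_add]; congr 2; push_cast; ring

end Energy

/-! ### Exponential groups of bounded operators -/

section BoundedSemigroup

variable {E : Type*} [NormedAddCommGroup E] [InnerProductSpace ℂ E] [CompleteSpace E]

/-- The group `t ↦ exp (-t K)` of a bounded operator. -/
noncomputable def expGroup (K : E →L[ℂ] E) (t : ℝ) : E →L[ℂ] E := NormedSpace.exp (t • (-K))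

theorem expGroup_zero (K : E →L[ℂ] E) : expGroup K 0 = 1 := by
  simp [expGroup]

theorem expGroup_add (K : E →L[ℂ] E) (s t : ℝ) :
    expGroup K (s + t) = expGroup K s * expGroup K t := by
  let _ : NormedAlgebra ℚ (E →L[ℂ] E) := NormedAlgebra.restrictScalars ℚ ℂ _
  rw [expGroup, add_smul]
  exact NormedSpace.exp_add_of_commute (((Commute.refl (-K)).smul_left s).smul_right t)

theorem hasDerivAt_expGroup (K : E →L[ℂ] E) (t : ℝ) :
    HasDerivAt (expGroup K) (-(expGroup K t * K)) t := by
  have := hasDerivAt_exp_smul_const (𝕂 := ℝ) (-K) t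
  rwa [mul_neg] at this

theorem commute_expGroup {K L : E →L[ℂ] E} (h : Commute K L) (t : ℝ) :
    Commute (expGroup K t) L := by
  let _ : NormedAlgebra ℚ (E →L[ℂ] E) := NormedAlgebra.restrictScalars ℚ ℂ _
  exact ((h.neg_left).smul_left t).exp_left

theorem hasDerivAt_expGroup_apply (K : E →L[ℂ] E) (x : E) (t : ℝ) :
    HasDerivAt (fun s => expGroup K s x) (-(expGroup K t (K x))) t := by
  have h := (hasDerivAt_expGroup K t)
  exact ((ContinuousLinearMap.apply ℂ E x).restrictScalars ℝ).hasFDerivAt.comp_hasDerivAt t h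

/-- `K` commutes with its exponential, so the orbit solves `u' = -Ku` and Gronwall applies. The
bound depends on `κ` alone, not on `‖K‖`. -/
theorem norm_expGroup_apply_le {K : E →L[ℂ] E} {κ : ℝ}
    (hK : ∀ x, -κ * ‖x‖ ^ 2 ≤ (inner ℂ x (K x)).re) {t : ℝ} (ht : 0 ≤ t) (x : E) :
    ‖expGroup K t x‖ ≤ Real.exp (κ * t) * ‖x‖ := by
  have h := norm_le_exp_mul_of_re_inner_le (κ := κ) (hasDerivAt_expGroup_apply K x)
    (fun s => by
      have h1 : expGroup K s (K x) = K (expGroup K s x) :=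
        DFunLike.congr_fun (commute_expGroup (Commute.refl K) s).eq x
      rw [h1, inner_neg_right, Complex.neg_re]
      linarith [hK (expGroup K s x)]) ht
  simpa [expGroup_zero] using h

/-- Interpolate along `r ↦ exp (-(t - r)L) exp (-rK) x`. By commutativity its derivative is the same
product applied to `Lx - Kx`, so closeness on the single vector `x` suffices. -/
theorem norm_expGroup_sub_le {K L : E →L[ℂ] E} (hKL : Commute K L) {κ : ℝ}
    (hK : ∀ x, -κ * ‖x‖ ^ 2 ≤ (inner ℂ x (K x)).re)
    (hL : ∀ x, -κ * ‖x‖ ^ 2 ≤ (inner ℂ x (L x)).re) {t : ℝ} (ht : 0 ≤ t) (x : E) :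
    ‖expGroup K t x - expGroup L t x‖ ≤ Real.exp (κ * t) * ‖K x - L x‖ * t := by
  have hd : ∀ s, HasDerivAt (fun r => expGroup L (t - r) (expGroup K r x))
      (expGroup L (t - s) (expGroup K s (L x - K x))) s := fun s => by
    have h1 : HasDerivAt (fun r => expGroup L (t - r)) (expGroup L (t - s) * L) s := by
      exact ((hasDerivAt_expGroup L (t - s)).comp_const_sub t s).congr_deriv (neg_neg _)
    have h2 := h1.mul (hasDerivAt_expGroup K s)
    have h3 := ((ContinuousLinearMap.apply ℂ E x).restrictScalars ℝ).hasFDerivAt.comp_hasDerivAt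
      s h2
    refine h3.congr_deriv ?_
    have h4 : expGroup K s (L x) = L (expGroup K s x) :=
      DFunLike.congr_fun (commute_expGroup hKL s).eq x
    simp [h4, sub_eq_add_neg]
  have h := norm_image_sub_le_of_norm_deriv_le_segment' (a := 0) (b := t)
    (C := Real.exp (κ * t) * ‖K x - L x‖) (fun s _ => (hd s).hasDerivWithinAt)
    (fun s hs => by
      refine (norm_expGroup_apply_le hL (sub_nonneg.2 hs.2.le) _).trans ?_
      refine (mul_le_mul_of_nonneg_left (norm_expGroup_apply_le hK hs.1 _)
        (Real.exp_pos _).le).trans_eq ?_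
      rw [← mul_assoc, ← Real.exp_add, norm_sub_rev]
      congr 2; ring) t (Set.right_mem_Icc.2 ht)
  simpa [expGroup_zero] using h

end BoundedSemigroup

/-! ### Limits of exponential semigroups -/

section Approximation

open Filter Topology

variable {E : Type*} [NormedAddCommGroup E] [InnerProductSpace ℂ E] [CompleteSpace E]

/-- An `ε/3` argument: the comparison estimate handles vectors of `D`, and the common bound `exp
(κa)` carries it over to the closure. -/
theorem uniformCauchySeqOn_expGroup {K : ℕ → E →L[ℂ] E} (hcomm : ∀ m n, Commute (K m) (K n))
    {κ : ℝ} (hκ : 0 ≤ κ) (hK : ∀ n x, -κ * ‖x‖ ^ 2 ≤ (inner ℂ x (K n x)).re)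
    {D : Set E} (hD : Dense D) (hlim : ∀ x ∈ D, CauchySeq fun n => K n x) (x : E) (a : ℝ≥0) :
    UniformCauchySeqOn (fun n (t : ℝ≥0) => expGroup (K n) t x) atTop (Set.Iic a) := by
  rw [Metric.uniformCauchySeqOn_iff]
  intro ε hε
  set M := Real.exp (κ * a) with hM
  have hM0 : 0 < M := Real.exp_pos _
  obtain ⟨z, hz, hzx⟩ := Metric.dense_iff.1 hD x (ε / (3 * M)) (by positivity)
  rw [Metric.mem_ball, dist_eq_norm, norm_sub_rev, lt_div_iff₀ (by positivity)] at hz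
  -- `a + 1` instead of `a` keeps the denominator positive when `a = 0`.
  obtain ⟨N, hN⟩ := Metric.cauchySeq_iff.1 (hlim z hzx) (ε / (3 * M * (a + 1))) (by positivity)
  refine ⟨N, fun m hm n hn t ht => ?_⟩
  have hta : (t : ℝ) ≤ a := ht
  have hexp : Real.exp (κ * t) ≤ M := Real.exp_le_exp.2 (by gcongr)
  have h1 : ∀ k, ‖expGroup (K k) t (x - z)‖ ≤ M * ‖x - z‖ := fun k =>
    (norm_expGroup_apply_le (hK k) t.2 _).trans
      (mul_le_mul_of_nonneg_right hexp (norm_nonneg _))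
  have h2 := hN m hm n hn
  rw [dist_eq_norm, lt_div_iff₀ (by positivity)] at h2
  have h3 : ‖expGroup (K m) t z - expGroup (K n) t z‖ ≤ M * ‖K m z - K n z‖ * (a + 1) :=
    (norm_expGroup_sub_le (hcomm m n) (hK m) (hK n) t.2 z).trans
      (mul_le_mul (mul_le_mul_of_nonneg_right hexp (norm_nonneg _))
        (hta.trans (le_add_of_nonneg_right zero_le_one)) t.2 (by positivity))
  have h4 : expGroup (K m) t x - expGroup (K n) t x = expGroup (K m) t (x - z) -
      expGroup (K n) t (x - z) + (expGroup (K m) t z - expGroup (K n) t z) := by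
    simp only [map_sub]; abel
  rw [dist_eq_norm, h4]
  have h5 := norm_add_le (expGroup (K m) t (x - z) -
      expGroup (K n) t (x - z)) (expGroup (K m) t z - expGroup (K n) t z)
  have h6 := norm_sub_le (expGroup (K m) t (x - z)) (expGroup (K n) t (x - z))
  linarith [h1 m, h1 n]

/-- If the bounded operators `K n` commute, are uniformly quasi-accretive and converge on a dense
set, then the semigroups `exp (-t K n)` converge to a strongly continuous semigroup, whose
generator extends the limit of the `K n`. -/
theorem exists_semigroup_of_approximation {K : ℕ → E →L[ℂ] E}
    (hcomm : ∀ m n, Commute (K m) (K n))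
    {κ : ℝ} (hκ : 0 ≤ κ) (hK : ∀ n x, -κ * ‖x‖ ^ 2 ≤ (inner ℂ x (K n x)).re)
    {D : Set E} (hD : Dense D) (hlim : ∀ x ∈ D, CauchySeq fun n => K n x) :
    ∃ T : ℝ≥0 → E →L[ℂ] E, IsSCSemigroup T ∧
      (∀ (t : ℝ≥0) x, ‖T t x‖ ≤ Real.exp (κ * t) * ‖x‖) ∧
      ∀ x y, Tendsto (fun n => K n x) atTop (𝓝 y) →
        Tendsto (fun t : ℝ≥0 => (t : ℝ)⁻¹ • (x - T t x)) (𝓝[>] 0) (𝓝 y) := by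
  have hunif := uniformCauchySeqOn_expGroup hcomm hκ hK hD hlim
  have hex : ∀ (t : ℝ≥0) (x : E), ∃ y, Tendsto (fun n => expGroup (K n) t x) atTop (𝓝 y) :=
    fun t x => cauchySeq_tendsto_of_complete
      ((hunif x t).cauchySeq (Set.mem_Iic.2 le_rfl))
  choose f hf using hex
  have hbound : ∀ (t : ℝ≥0) n x, ‖expGroup (K n) t x‖ ≤ Real.exp (κ * t) * ‖x‖ :=
    fun t n x => norm_expGroup_apply_le (hK n) t.2 x
  have hfbound : ∀ t x, ‖f t x‖ ≤ Real.exp (κ * t) * ‖x‖ := fun t x =>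
    le_of_tendsto (hf t x).norm (Eventually.of_forall fun n => hbound t n x)
  let T : ℝ≥0 → E →L[ℂ] E := fun t => LinearMap.mkContinuous
    { toFun := f t
      map_add' := fun x y => tendsto_nhds_unique (hf t (x + y))
        (by simpa only [map_add] using (hf t x).add (hf t y))
      map_smul' := fun c x => tendsto_nhds_unique (hf t (c • x))
        (by simpa only [map_smul, RingHom.id_apply] using (hf t x).const_smul c) }
    (Real.exp (κ * t)) (hfbound t)
  have hT : ∀ (t : ℝ≥0) x, Tendsto (fun n => expGroup (K n) t x) atTop (𝓝 (T t x)) := hf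
  have hTb : ∀ (t : ℝ≥0) x, ‖T t x‖ ≤ Real.exp (κ * t) * ‖x‖ := hfbound
  have hTu : ∀ x a, TendstoUniformlyOn (fun n (t : ℝ≥0) => expGroup (K n) t x)
      (fun t => T t x) atTop (Set.Iic a) := fun x a =>
    (hunif x a).tendstoUniformlyOn_of_tendsto fun t _ => hT t x
  have hcont : ∀ x, Continuous fun t => T t x := fun x => by
    refine continuous_iff_continuousAt.2 fun t => ?_
    have h1 : ContinuousOn (fun t => T t x) (Set.Iic (t + 1)) := by
      refine (hTu x (t + 1)).continuousOn (Frequently.of_forall fun n => ?_)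
      exact Continuous.continuousOn (by
        have : Continuous fun s : ℝ => expGroup (K n) s x :=
          continuous_iff_continuousAt.2 fun s => (hasDerivAt_expGroup_apply (K n) x s).continuousAt
        exact this.comp NNReal.continuous_coe)
    exact h1.continuousAt (Iic_mem_nhds (lt_add_one t))
  refine ⟨T, ⟨?_, fun s t => ?_, hcont⟩, hTb, fun x y hxy => ?_⟩
  · ext x
    refine tendsto_nhds_unique (hT 0 x) ?_
    simp [expGroup_zero]
  · ext x
    refine tendsto_nhds_unique (hT (s + t) x) ?_
    -- Bounds uniform in `n` let the limits in the two factors be taken together.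
    have h1 : Tendsto (fun n => expGroup (K n) s (expGroup (K n) t x - T t x)) atTop (𝓝 0) := by
      refine squeeze_zero_norm (fun n => hbound s n _) ?_
      simpa using ((hT t x).sub_const (T t x)).norm.const_mul (Real.exp (κ * s))
    refine ((h1.add (hT s (T t x))).congr fun n => ?_).trans_eq (by rw [zero_add]; rfl)
    rw [← map_add, sub_add_cancel, NNReal.coe_add, expGroup_add]
    rfl
  · rw [Metric.tendsto_nhds]
    intro ε hε
    have hT0 : T 0 y = y := tendsto_nhds_unique (hT 0 y) (by simp [expGroup_zero])
    have hc : ∀ᶠ s in 𝓝 (0 : ℝ≥0), dist (T s y) y < ε / 4 := by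
      have := (hcont y).tendsto 0
      rw [hT0] at this
      exact Metric.tendsto_nhds.1 this _ (by positivity)
    obtain ⟨δ, hδ, hδc⟩ := Metric.eventually_nhds_iff.1 hc
    -- The cap at 1 gives `exp (κs) ≤ exp κ` and uniform convergence on `[0, 1]` for all `s < t`.
    have hsmall : ∀ᶠ t : ℝ≥0 in 𝓝[>] 0, t < δ.toNNReal ⊓ 1 ∧ 0 < t := by
      refine (eventually_nhdsWithin_of_eventually_nhds
        (eventually_lt_nhds ?_)).and self_mem_nhdsWithin
      simp [hδ]
    filter_upwards [hsmall] with t ⟨ht, ht0⟩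
    have ht1 : t < δ.toNNReal := lt_of_lt_of_le ht inf_le_left
    have ht2 : t < 1 := lt_of_lt_of_le ht inf_le_right
    have ht3 : (t : ℝ) < δ := Real.lt_toNNReal_iff_coe_lt.1 ht1
    have ht0' : (0 : ℝ) < t := ht0
    have ht2' : (t : ℝ) < 1 := ht2
    have e1 : ∀ᶠ n in atTop, dist (K n x) y < ε / (4 * Real.exp κ) :=
      Metric.tendsto_nhds.1 hxy _ (by positivity)
    have e2 := Metric.tendstoUniformlyOn_iff.1 (hTu y 1) (ε / 4) (by positivity)
    -- Mean value inequality for `s ↦ exp (-sK_n)x + sy`. Its derivative splits into three errors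
    -- below `ε/4`: `K_n x` against `y`, `exp (-sK_n)y` against `T(s)y`, and `T(s)y` against `y`.
    -- The total `3ε/4` leaves room for a strict inequality in the limit.
    have key : ∀ᶠ n in atTop, ‖(expGroup (K n) t x - x) + (t : ℝ) • y‖ ≤ 3 * ε / 4 * t := by
      filter_upwards [e1, e2] with n h1 h2
      have hd : ∀ s : ℝ, HasDerivAt (fun s => expGroup (K n) s x + s • y)
          (-(expGroup (K n) s (K n x)) + (1 : ℝ) • y) s := fun s =>
        (hasDerivAt_expGroup_apply (K n) x s).add ((hasDerivAt_id s).smul_const y)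
      have h := norm_image_sub_le_of_norm_deriv_le_segment' (a := 0) (b := (t : ℝ))
        (C := 3 * ε / 4) (fun s _ => (hd s).hasDerivWithinAt) (fun s hs => ?_) t
        (Set.right_mem_Icc.2 ht0'.le)
      · simpa [expGroup_zero, add_sub_right_comm] using h
      · obtain ⟨hs0, hst⟩ := hs
        lift s to ℝ≥0 using hs0
        have i1 : ‖expGroup (K n) s (K n x - y)‖ < ε / 4 := by
          refine (hbound s n _).trans_lt ?_
          rw [dist_eq_norm, lt_div_iff₀ (by positivity)] at h1
          have : Real.exp (κ * s) ≤ Real.exp κ := Real.exp_le_exp.2 (by nlinarith)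
          nlinarith [norm_nonneg (K n x - y)]
        have i2 := h2 s (Set.mem_Iic.2 (NNReal.coe_le_coe.1 (by push_cast; linarith)))
        have i3 : dist (T s y) y < ε / 4 := hδc (by
          rw [NNReal.dist_eq]; simp; linarith)
        rw [dist_comm, dist_eq_norm] at i2
        rw [dist_eq_norm] at i3
        have i4 : -(expGroup (K n) s (K n x)) + (1 : ℝ) • y =
            -(expGroup (K n) s (K n x - y) + (expGroup (K n) s y - T s y) + (T s y - y)) := by
          rw [map_sub, one_smul]; abel
        rw [i4, norm_neg]
        refine (norm_add₃_le).trans ?_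
        linarith
    have hle : ‖(T t x - x) + (t : ℝ) • y‖ ≤ 3 * ε / 4 * t :=
      le_of_tendsto (((hT t x).sub_const x).add_const _).norm key
    have heq : (t : ℝ)⁻¹ • (x - T t x) - y = -((t : ℝ)⁻¹ • ((T t x - x) + (t : ℝ) • y)) := by
      rw [smul_add, smul_smul, inv_mul_cancel₀ ht0'.ne', one_smul, neg_add, ← smul_neg, neg_sub]
      abel
    rw [dist_eq_norm, heq, norm_neg, norm_smul, norm_inv, Real.norm_of_nonneg ht0'.le,
      inv_mul_lt_iff₀ ht0']
    nlinarith

end Approximation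

/-! ### Quasi-`m`-accretive operators and the Hille-Yosida theorem -/

section HilleYosida

open Filter Topology

variable {E : Type*} [NormedAddCommGroup E] [InnerProductSpace ℂ E]

/-- A quasi-`m`-accretive operator in a Hilbert space. -/
structure IsQuasiMAccretive (G : E →ₗ.[ℂ] E) : Prop where
  accretive : ∃ ω : ℝ, 0 ≤ ω ∧ ∀ x y, (x, y) ∈ G.graph → -ω * ‖x‖ ^ 2 ≤ (inner ℂ x y).re
  surjective : ∃ l₀ : ℝ, ∀ l : ℝ, l₀ < l → ∀ y, ∃ x z, (x, z) ∈ G.graph ∧ (l : ℂ) • x + z = y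

theorem re_inner_ofReal_smul_right (l : ℝ) (x y : E) :
    (inner ℂ x ((l : ℂ) • y)).re = l * (inner ℂ x y).re := by
  rw [inner_smul_right, Complex.re_ofReal_mul]

/-- Pair `lx + z` with `x` and apply Cauchy-Schwarz. -/
theorem sub_mul_norm_le_of_accretive {x z : E} {ω : ℝ}
    (h : -ω * ‖x‖ ^ 2 ≤ (inner ℂ x z).re) (l : ℝ) : (l - ω) * ‖x‖ ≤ ‖(l : ℂ) • x + z‖ := by
  have h1 : (inner ℂ x ((l : ℂ) • x + z)).re ≤ ‖x‖ * ‖(l : ℂ) • x + z‖ :=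
    re_inner_le_norm (𝕜 := ℂ) _ _
  rw [inner_add_right, Complex.add_re, re_inner_ofReal_smul_right, re_inner_self_eq_norm_sq] at h1
  rcases (norm_nonneg x).eq_or_lt with h0 | h0
  · rw [← h0, mul_zero]; exact norm_nonneg _
  · refine le_of_mul_le_mul_left ?_ h0
    nlinarith

/-- If `y` is orthogonal to the domain, solve `lx + Gx = y` with `l > ω` and pair with `x`: then `0
≥ (l - ω)‖x‖²`, so `x = 0` and `y = 0`. -/
theorem IsQuasiMAccretive.dense_domain [CompleteSpace E] {G : E →ₗ.[ℂ] E}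
    (hG : IsQuasiMAccretive G) : Dense (G.domain : Set E) := by
  obtain ⟨ω, hω, hacc⟩ := hG.accretive
  obtain ⟨l₀, hsurj⟩ := hG.surjective
  rw [Submodule.dense_iff_topologicalClosure_eq_top,
    Submodule.topologicalClosure_eq_top_iff, Submodule.eq_bot_iff]
  intro y hy
  obtain ⟨x, z, hxz, h⟩ := hsurj (max l₀ ω + 1) (by linarith [le_max_left l₀ ω]) y
  have h1 : inner ℂ x y = 0 :=
    (Submodule.mem_orthogonal _ _).mp hy x (LinearPMap.mem_domain_of_mem_graph hxz)
  have h2 := hacc x z hxz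
  have h3 : (inner ℂ x y).re = 0 := by rw [h1]; rfl
  rw [← h, inner_add_right, Complex.add_re, re_inner_ofReal_smul_right,
    re_inner_self_eq_norm_sq] at h3
  have h4 : x = 0 := by
    have : ‖x‖ ^ 2 ≤ 0 := by nlinarith [le_max_right l₀ ω, sq_nonneg ‖x‖]
    exact norm_eq_zero.1 (pow_eq_zero_iff two_ne_zero |>.1 (le_antisymm this (sq_nonneg _)))
  have h5 : z = 0 := by
    subst h4
    exact LinearPMap.graph_fst_eq_zero_snd G hxz rfl
  rw [← h, h4, h5, smul_zero, add_zero]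

/-- The resolvent of a quasi-`m`-accretive operator. -/
theorem IsQuasiMAccretive.exists_resolvent {G : E →ₗ.[ℂ] E} (hG : IsQuasiMAccretive G) :
    ∃ ω : ℝ, 0 ≤ ω ∧ (∀ x y, (x, y) ∈ G.graph → -ω * ‖x‖ ^ 2 ≤ (inner ℂ x y).re) ∧
      ∃ l₀ : ℝ, 0 < l₀ ∧ ∃ R : ℝ → E →L[ℂ] E, ∀ l, l₀ < l →
        (∀ y, (R l y, y - (l : ℂ) • R l y) ∈ G.graph) ∧
        (∀ x z, (x, z) ∈ G.graph → R l ((l : ℂ) • x + z) = x) ∧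
        ∀ y, l * ‖R l y‖ ≤ 2 * ‖y‖ := by
  obtain ⟨ω, hω, hacc⟩ := hG.accretive
  obtain ⟨l₁, hsurj⟩ := hG.surjective
  -- `l > 2ω` gives `l - ω ≥ l/2`, the source of the factor 2; `l > 1` then yields the operator
  -- bound 2.
  refine ⟨ω, hω, hacc, max l₁ (2 * ω) ⊔ 1, by simp, ?_⟩
  suffices h : ∀ l, max l₁ (2 * ω) ⊔ 1 < l → ∃ R : E →L[ℂ] E,
      (∀ y, (R y, y - (l : ℂ) • R y) ∈ G.graph) ∧
        (∀ x z, (x, z) ∈ G.graph → R ((l : ℂ) • x + z) = x) ∧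
        ∀ y, l * ‖R y‖ ≤ 2 * ‖y‖ by
    choose! R hR using h
    exact ⟨R, hR⟩
  intro l hl
  obtain ⟨⟨hl1, hl2⟩, hl3⟩ : (l₁ < l ∧ 2 * ω < l) ∧ 1 < l := by simpa using hl
  have hbd : ∀ x z, (x, z) ∈ G.graph → l * ‖x‖ ≤ 2 * ‖(l : ℂ) • x + z‖ := fun x z hxz => by
    have := sub_mul_norm_le_of_accretive (hacc x z hxz) l
    nlinarith [norm_nonneg x]
  choose r s hrs hr using hsurj l hl1
  have huniq : ∀ x z, (x, z) ∈ G.graph → ∀ y, (l : ℂ) • x + z = y → x = r y :=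
    fun x z hxz y hy => by
      have h1 := hbd _ _ (G.graph.sub_mem hxz (hrs y))
      have h2 : (l : ℂ) • (x - r y) + (z - s y) = 0 := by
        rw [← sub_eq_zero.2 (hy.trans (hr y).symm), smul_sub]; abel
      rw [h2, norm_zero, mul_zero] at h1
      exact sub_eq_zero.1 (norm_le_zero_iff.1 (by nlinarith [norm_nonneg (x - r y)]))
  let R₀ : E →ₗ[ℂ] E :=
    { toFun := r
      map_add' := fun x y => (huniq _ _ (G.graph.add_mem (hrs x) (hrs y)) _ (by
        conv_rhs => rw [← hr x, ← hr y]
        rw [smul_add]; abel)).symm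
      map_smul' := fun c x => (huniq _ _ (G.graph.smul_mem c (hrs x)) _ (by
        conv_rhs => rw [← hr x]
        rw [smul_add, smul_comm])).symm }
  have hRb : ∀ y, l * ‖r y‖ ≤ 2 * ‖y‖ := fun y => by
    conv_rhs => rw [← hr y]
    exact hbd _ _ (hrs y)
  refine ⟨R₀.mkContinuous 2 fun y => ?_, fun y => ?_, fun x z hxz => ?_, hRb⟩
  · have : ‖r y‖ ≤ 2 * ‖y‖ := by nlinarith [hRb y, norm_nonneg (r y)]
    exact this
  · have : y - (l : ℂ) • r y = s y := by rw [sub_eq_iff_eq_add, add_comm]; exact (hr y).symm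
    change (r y, y - (l : ℂ) • r y) ∈ _
    rw [this]
    exact hrs y
  · exact (huniq x z hxz _ rfl).symm

/-- Maximality: for large `l`, `l + P` is injective while `l + G` is already onto, so a
quasi-accretive `P` has no room to be larger. -/
theorem IsQuasiMAccretive.mem_graph_of_extension {G : E →ₗ.[ℂ] E} (hG : IsQuasiMAccretive G)
    {P : Submodule ℂ (E × E)} (hP : G.graph ≤ P) {κ : ℝ}
    (hacc : ∀ x y, (x, y) ∈ P → -κ * ‖x‖ ^ 2 ≤ (inner ℂ x y).re) : P ≤ G.graph := by
  rintro ⟨x, y⟩ hxy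
  obtain ⟨l₀, hsurj⟩ := hG.surjective
  set l := max l₀ κ + 1
  have hl : κ < l := by linarith [le_max_right l₀ κ]
  obtain ⟨z, w, hzw, h⟩ := hsurj l (by linarith [le_max_left l₀ κ]) ((l : ℂ) • x + y)
  have h1 := sub_mul_norm_le_of_accretive (hacc _ _ (P.sub_mem hxy (hP hzw))) l
  have h2 : (l : ℂ) • (x - z) + (y - w) = 0 := by
    rw [← sub_eq_zero.2 h.symm, smul_sub]; abel
  change (l - κ) * ‖x - z‖ ≤ ‖(l : ℂ) • (x - z) + (y - w)‖ at h1
  rw [h2, norm_zero] at h1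
  have h3 : x - z = 0 := norm_le_zero_iff.1 (by nlinarith [norm_nonneg (x - z)])
  rw [h3, smul_zero, zero_add] at h2
  rw [sub_eq_zero.1 h3, sub_eq_zero.1 h2]
  exact hzw

/-- The Hille-Yosida-Lumer-Phillips theorem: quasi-`m`-accretive operators are generators. -/
theorem IsQuasiMAccretive.exists_generates [CompleteSpace E] {G : E →ₗ.[ℂ] E}
    (hG : IsQuasiMAccretive G) : ∃ T : ℝ≥0 → E →L[ℂ] E, Generates G T := by
  obtain ⟨ω, hω, hacc, l₀, hl₀, R, hR⟩ := hG.exists_resolvent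
  have hRcomm : ∀ l m, l₀ < l → l₀ < m → Commute (R l) (R m) := fun l m hl hm => by
    rcases eq_or_ne l m with rfl | hlm
    · exact Commute.refl _
    -- The resolvent identity; using it with `l` and `m` exchanged forces commutation.
    have key : ∀ l m, l₀ < l → l₀ < m → ∀ y,
        R m y + ((m : ℂ) - l) • R m (R l y) = R l y := fun l m hl hm y => by
      have := (hR m hm).2.1 _ _ ((hR l hl).1 y)
      rw [← map_smul, ← map_add]
      convert this using 2
      rw [sub_smul]; abel
    ext y
    have h1 := key l m hl hm y
    have h2 := key m l hm hl y
    have h3 : ((m : ℂ) - l) • (R m (R l y) - R l (R m y)) = 0 := by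
      have h4 : ((m : ℂ) - l) • R m (R l y) = R l y - R m y := eq_sub_iff_add_eq'.2 h1
      have h5 : ((l : ℂ) - m) • R l (R m y) = R m y - R l y := eq_sub_iff_add_eq'.2 h2
      rw [smul_sub, h4, ← neg_sub (l : ℂ) m, neg_smul, h5]; abel
    have h6 : (m : ℂ) - l ≠ 0 := sub_ne_zero.2 fun h => hlm (Complex.ofReal_injective h).symm
    exact (sub_eq_zero.1 ((smul_eq_zero.1 h3).resolve_left h6)).symm
  let L : ℕ → ℝ := fun n => l₀ + 1 + n
  have hL : ∀ n, l₀ < L n := fun n => by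
    have : (0 : ℝ) ≤ n := n.cast_nonneg
    change l₀ < l₀ + 1 + n
    linarith
  have hLlim : Tendsto L atTop atTop := tendsto_atTop_add_const_left _ _ tendsto_natCast_atTop_atTop
  -- Yosida approximation: on the domain this equals `L R(L) G`.
  let K : ℕ → E →L[ℂ] E := fun n => (L n : ℂ) • (1 - (L n : ℂ) • R (L n))
  have hKcomm : ∀ m n, Commute (K m) (K n) := fun m n => by
    refine Commute.smul_left (Commute.smul_right ?_ _) _
    refine Commute.sub_left (Commute.one_left _) (Commute.sub_right (Commute.one_right _) ?_)
    exact Commute.smul_left (Commute.smul_right (hRcomm _ _ (hL m) (hL n)) _) _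
  -- With `y = R(l)x` and `z = Gy`, `Re ⟨x|Kx⟩ = l² Re ⟨y|z⟩ + l‖z‖² ≥ -ω(l‖y‖)²`. The constant `4ω`
  -- comes from `l‖y‖ ≤ 2‖x‖`.
  have hKacc : ∀ n x, -(4 * ω) * ‖x‖ ^ 2 ≤ (inner ℂ x (K n x)).re := fun n x => by
    have hl := hL n
    change _ ≤ (inner ℂ x ((L n : ℂ) • (x - (L n : ℂ) • R (L n) x))).re
    generalize L n = l at hl
    set y := R l x with hy
    set z := x - (l : ℂ) • y with hz
    have hyz : (y, z) ∈ G.graph := (hR l hl).1 x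
    have hx : x = (l : ℂ) • y + z := by rw [hz]; abel
    have h1 := hacc y z hyz
    have h2 : l * ‖y‖ ≤ 2 * ‖x‖ := (hR l hl).2.2 x
    have h3 : (inner ℂ x ((l : ℂ) • z)).re = l * (l * (inner ℂ y z).re + ‖z‖ ^ 2) := by
      rw [re_inner_ofReal_smul_right]
      nth_rw 1 [hx]
      rw [inner_add_left, Complex.add_re, re_inner_self_eq_norm_sq, inner_smul_left,
        Complex.conj_ofReal, Complex.re_ofReal_mul]
    rw [h3]
    have hl0 : 0 < l := hl₀.trans hl
    have h4 : (l * ‖y‖) ^ 2 ≤ (2 * ‖x‖) ^ 2 := pow_le_pow_left₀ (by positivity) h2 2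
    have h5 : 0 ≤ l * ‖z‖ ^ 2 := by positivity
    have h6 : l ^ 2 * (-ω * ‖y‖ ^ 2) ≤ l ^ 2 * (inner ℂ y z).re :=
      mul_le_mul_of_nonneg_left h1 (by positivity)
    nlinarith [mul_le_mul_of_nonneg_left h4 hω]
  -- On the domain the error is `R(L)Gx = O(1/L)`; density and the uniform bound 2 extend this to
  -- all vectors.
  have hlR : ∀ y, Tendsto (fun n => (L n : ℂ) • R (L n) y) atTop (𝓝 y) := by
    have hdom : ∀ x z, (x, z) ∈ G.graph →
        Tendsto (fun n => (L n : ℂ) • R (L n) x) atTop (𝓝 x) := fun x z hxz => by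
      have h1 : ∀ n, (L n : ℂ) • R (L n) x = x - R (L n) z := fun n => by
        have := (hR _ (hL n)).2.1 x z hxz
        rw [map_add, map_smul] at this
        rw [eq_sub_iff_add_eq, this]
      have h2 : Tendsto (fun n => R (L n) z) atTop (𝓝 0) := by
        refine squeeze_zero_norm (a := fun n => (2 * ‖z‖) / L n) (fun n => ?_)
          (hLlim.const_div_atTop _)
        rw [le_div_iff₀ (hl₀.trans (hL n)), mul_comm]
        exact (hR _ (hL n)).2.2 z
      simp_rw [h1]
      simpa using h2.const_sub x
    intro y
    rw [Metric.tendsto_nhds]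
    intro ε hε
    obtain ⟨x, hxy, hx⟩ := Metric.dense_iff.1 hG.dense_domain y (ε / 4) (by positivity)
    rw [Metric.mem_ball, dist_eq_norm] at hxy
    filter_upwards [Metric.tendsto_nhds.1 (hdom x _ (G.mem_graph ⟨x, hx⟩)) (ε / 4)
      (by positivity)] with n hn
    have h1 : ‖(L n : ℂ) • R (L n) (x - y)‖ ≤ 2 * ‖x - y‖ := by
      rw [norm_smul, Complex.norm_real, Real.norm_of_nonneg (hl₀.trans (hL n)).le]
      exact (hR _ (hL n)).2.2 _
    have h2 : (L n : ℂ) • R (L n) y - y = -((L n : ℂ) • R (L n) (x - y)) +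
        ((L n : ℂ) • R (L n) x - x) + (x - y) := by
      rw [map_sub, smul_sub]; abel
    rw [dist_eq_norm] at hn ⊢
    rw [h2]
    refine norm_add₃_le.trans_lt ?_
    rw [norm_neg]
    linarith
  have hKlim : ∀ x z, (x, z) ∈ G.graph → Tendsto (fun n => K n x) atTop (𝓝 z) :=
    fun x z hxz => by
      refine (hlR z).congr fun n => ?_
      have := (hR _ (hL n)).2.1 x z hxz
      rw [map_add, map_smul] at this
      change _ = (L n : ℂ) • (x - (L n : ℂ) • R (L n) x)
      rw [← sub_eq_iff_eq_add'.2 this.symm]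
  obtain ⟨T, hT, hTb, hTG⟩ := exists_semigroup_of_approximation hKcomm (by positivity) hKacc
    hG.dense_domain fun x hx => (hKlim x _ (G.mem_graph ⟨x, hx⟩)).cauchySeq
  refine ⟨T, hT, ?_⟩
  -- `P` is the graph of the actual generator of `T`. It contains that of `G`, and `‖T(t)‖ ≤ exp
  -- (4ωt)`, differentiated at 0, makes it quasi-accretive; maximality gives equality.
  let P : Submodule ℂ (E × E) :=
    { carrier := {p | Tendsto (fun t : ℝ≥0 => (t : ℝ)⁻¹ • (p.1 - T t p.1)) (𝓝[>] 0) (𝓝 p.2)}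
      add_mem' := fun {p q} hp hq => by
        refine (Tendsto.add hp hq).congr fun t => ?_
        rw [← smul_add, Prod.fst_add, map_add]
        congr 1; abel
      zero_mem' := by simp
      smul_mem' := fun c p hp => by
        refine (Tendsto.const_smul hp c).congr fun t => ?_
        rw [Prod.smul_fst, map_smul, ← smul_sub, smul_comm] }
  have hPG : P ≤ G.graph := by
    refine hG.mem_graph_of_extension (κ := 4 * ω) (fun p hp => hTG _ _ (hKlim _ _ hp))
      fun x y hxy => ?_
    have h1 : Tendsto (fun t : ℝ≥0 => (inner ℂ x ((t : ℝ)⁻¹ • (x - T t x))).re) (𝓝[>] 0)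
        (𝓝 (inner ℂ x y).re) :=
      (Complex.continuous_re.tendsto _).comp (Tendsto.inner tendsto_const_nhds hxy)
    have h2 : Tendsto (fun t : ℝ≥0 => -((t : ℝ)⁻¹ * (Real.exp (4 * ω * t) - 1)) * ‖x‖ ^ 2)
        (𝓝[>] 0) (𝓝 (-(4 * ω) * ‖x‖ ^ 2)) := by
      have h3 : HasDerivAt (fun t : ℝ => Real.exp (4 * ω * t)) (4 * ω) 0 := by
        simpa using ((hasDerivAt_id (0 : ℝ)).const_mul (4 * ω)).exp
      have h4 := h3.tendsto_slope_zero_right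
      have h5 : Tendsto (fun t : ℝ≥0 => (t : ℝ)) (𝓝[>] 0) (𝓝[>] 0) :=
        tendsto_nhdsWithin_of_tendsto_nhds_of_eventually_within _
          ((NNReal.continuous_coe.tendsto' 0 0 rfl).mono_left nhdsWithin_le_nhds)
          (eventually_nhdsWithin_of_forall fun t ht => NNReal.coe_pos.2 ht)
      refine ((h4.comp h5).neg.mul_const (‖x‖ ^ 2)).congr fun t => ?_
      simp
    refine le_of_tendsto_of_tendsto h2 h1 ?_
    filter_upwards [self_mem_nhdsWithin] with t ht
    have ht0 : (0 : ℝ) < t := ht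
    have h6 : (inner ℂ x (T t x)).re ≤ Real.exp (4 * ω * t) * ‖x‖ ^ 2 := by
      have : (inner ℂ x (T t x)).re ≤ ‖x‖ * ‖T t x‖ := re_inner_le_norm (𝕜 := ℂ) _ _
      nlinarith [hTb t x, norm_nonneg x]
    have h7 : ((t : ℝ)⁻¹ • (x - T t x)) = (((t : ℝ)⁻¹ : ℝ) : ℂ) • (x - T t x) :=
      (Complex.coe_smul _ _).symm
    rw [h7, re_inner_ofReal_smul_right, inner_sub_right, Complex.sub_re,
      re_inner_self_eq_norm_sq, neg_mul, mul_assoc, ← mul_neg]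
    refine mul_le_mul_of_nonneg_left ?_ (inv_nonneg.2 ht0.le)
    linarith
  exact fun x y => ⟨fun h => hTG _ _ (hKlim _ _ h), fun h => hPG (show (x, y) ∈ P from h)⟩

end HilleYosida

/-! ### Evolution equation: existence, uniqueness and the group law -/

section Evolution

open Filter Topology

variable {E : Type*} [NormedAddCommGroup E] [InnerProductSpace ℂ E]

/-- `T(s)` commutes with the difference quotients and is continuous. -/
theorem Generates.map_mem_graph {G : E →ₗ.[ℂ] E} {T : ℝ≥0 → E →L[ℂ] E} (hT : Generates G T)
    {x y : E} (hxy : (x, y) ∈ G.graph) (s : ℝ≥0) : (T s x, T s y) ∈ G.graph := by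
  refine (hT.2 _ _).2 (((T s).continuous.tendsto y |>.comp ((hT.2 _ _).1 hxy)).congr fun t => ?_)
  have h1 : T t (T s x) = T s (T t x) := by
    have h2 := hT.1.map_add t s
    rw [add_comm, hT.1.map_add s t] at h2
    exact (DFunLike.congr_fun h2 x).symm
  rw [Function.comp_apply, h1, ← map_sub]
  exact ((T s).restrictScalars ℝ).map_smul _ _

theorem Generates.hasDerivWithinAt_Ioi {G : E →ₗ.[ℂ] E} {T : ℝ≥0 → E →L[ℂ] E}
    (hT : Generates G T) {x y : E} (hxy : (x, y) ∈ G.graph) {s : ℝ} (hs : 0 ≤ s) :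
    HasDerivWithinAt (fun r : ℝ => T r.toNNReal x) (-(T s.toNNReal y)) (Set.Ioi s) s := by
  rw [hasDerivWithinAt_iff_tendsto_slope' (by simp)]
  have h1 := (hT.2 _ _).1 (hT.map_mem_graph hxy s.toNNReal)
  have h2 : Tendsto (fun r : ℝ => (r - s).toNNReal) (𝓝[>] s) (𝓝[>] 0) := by
    refine tendsto_nhdsWithin_of_tendsto_nhds_of_eventually_within _ ?_
      (eventually_nhdsWithin_of_forall fun r hr => Real.toNNReal_pos.2 (sub_pos.2 hr))
    have : Continuous fun r : ℝ => (r - s).toNNReal := by fun_prop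
    exact (this.tendsto' s 0 (by simp)).mono_left nhdsWithin_le_nhds
  refine (h1.comp h2).neg.congr' ?_
  filter_upwards [self_mem_nhdsWithin] with r hr
  have hrs : 0 < r - s := sub_pos.2 hr
  have h3 : r.toNNReal = (r - s).toNNReal + s.toNNReal := by
    rw [← Real.toNNReal_add hrs.le hs, sub_add_cancel]
  rw [Function.comp_apply, slope_def_module, h3, hT.1.map_add, Real.coe_toNNReal _ hrs.le,
    ← smul_neg, neg_sub]
  rfl

/-- The generator only supplies right derivatives. Since these are continuous, the orbit is the
integral of `-T(s)y`, which upgrades them to derivatives within `[0, ∞)`. -/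
theorem Generates.hasDerivWithinAt_Ici [CompleteSpace E] {G : E →ₗ.[ℂ] E}
    {T : ℝ≥0 → E →L[ℂ] E} (hT : Generates G T) {x y : E} (hxy : (x, y) ∈ G.graph) {t : ℝ}
    (ht : 0 ≤ t) :
    HasDerivWithinAt (fun r : ℝ => T r.toNNReal x) (-(T t.toNNReal y)) (Set.Ici 0) t := by
  have hc : ∀ z, Continuous fun r : ℝ => T r.toNNReal z := fun z =>
    (hT.1.continuous_orbit z).comp continuous_real_toNNReal
  have hint : ∀ r, 0 ≤ r → T r.toNNReal x = x + ∫ s in (0 : ℝ)..r, -(T s.toNNReal y) :=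
    fun r hr => by
      rw [intervalIntegral.integral_eq_sub_of_hasDeriv_right (hc x).continuousOn
        (fun s hs => hT.hasDerivWithinAt_Ioi hxy (by simpa [hr] using hs.1.le))
        ((hc y).neg.intervalIntegrable _ _)]
      simp [hT.1.map_zero]
  refine HasDerivWithinAt.congr (f := fun r => x + ∫ s in (0 : ℝ)..r, -(T s.toNNReal y)) ?_
    (fun r hr => hint r hr) (hint t ht)
  exact ((((hc y).neg).integral_hasStrictDerivAt 0 t).hasDerivAt.const_add x).hasDerivWithinAt

/-- Time reversal turns the orbit of `G' = -G` into a solution for `G` on `(-∞, 0]`; at 0 both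
one-sided derivatives are `-Gx`. -/
theorem isSolution_glue [CompleteSpace E] {G G' : E →ₗ.[ℂ] E}
    (hGG' : ∀ x y, (x, y) ∈ G'.graph ↔ (x, -y) ∈ G.graph) {Tp Tm : ℝ≥0 → E →L[ℂ] E}
    (hp : Generates G Tp) (hm : Generates G' Tm) {x : E} (hx : x ∈ G.domain) :
    IsSolution G fun t => glue Tp Tm t x := by
  obtain ⟨y, hxy⟩ : ∃ y, (x, y) ∈ G.graph := ⟨_, G.mem_graph ⟨x, hx⟩⟩
  have hpos : ∀ t, 0 ≤ t → glue Tp Tm t = Tp t.toNNReal := fun t ht => if_pos ht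
  have hneg : ∀ t, t ≤ 0 → glue Tp Tm t = Tm (-t).toNNReal := fun t ht => by
    rcases ht.lt_or_eq with h | rfl
    · exact if_neg h.not_ge
    · rw [hpos 0 le_rfl]
      simp [hp.1.map_zero, hm.1.map_zero]
  have dpos : ∀ t, 0 ≤ t →
      HasDerivWithinAt (fun t => glue Tp Tm t x) (-(glue Tp Tm t y)) (Set.Ici 0) t := fun t ht => by
    rw [hpos t ht]
    exact (hp.hasDerivWithinAt_Ici hxy ht).congr (fun s hs => by rw [hpos s hs]) (by rw [hpos t ht])
  have hxy' : (x, -y) ∈ G'.graph := (hGG' _ _).2 (by rwa [neg_neg])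
  have dneg : ∀ t, t ≤ 0 →
      HasDerivWithinAt (fun t => glue Tp Tm t x) (-(glue Tp Tm t y)) (Set.Iic 0) t := fun t ht => by
    have h1 := (hm.hasDerivWithinAt_Ici hxy' (neg_nonneg.2 ht)).scomp t
      ((hasDerivAt_id t).neg.hasDerivWithinAt (s := Set.Iic 0)) fun s hs => neg_nonneg.2 hs
    rw [hneg t ht]
    refine (h1.congr (fun s hs => ?_) ?_).congr_deriv ?_
    · rw [hneg s hs]; rfl
    · rw [hneg t ht]; rfl
    · simp
  have hgraph : ∀ t, (glue Tp Tm t x, glue Tp Tm t y) ∈ G.graph := fun t => by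
    rcases le_total 0 t with ht | ht
    · rw [hpos t ht]; exact hp.map_mem_graph hxy _
    · rw [hneg t ht]
      have := (hGG' _ _).1 (hm.map_mem_graph hxy' (-t).toNNReal)
      rwa [map_neg, neg_neg] at this
  intro t
  have hval : ∀ h' : glue Tp Tm t x ∈ G.domain, G ⟨_, h'⟩ = glue Tp Tm t y := fun h' =>
    LinearPMap.mem_graph_snd_inj _ (G.mem_graph ⟨_, h'⟩) (hgraph t) rfl
  refine ⟨LinearPMap.mem_domain_of_mem_graph (hgraph t), ?_⟩
  rw [hval]
  rcases lt_trichotomy t 0 with ht | rfl | ht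
  · exact (dneg t ht.le).hasDerivAt (Iic_mem_nhds ht)
  · have := (dneg 0 le_rfl).union (dpos 0 le_rfl)
    rwa [Set.Iic_union_Ici, hasDerivWithinAt_univ] at this
  · exact (dpos t ht.le).hasDerivAt (Ici_mem_nhds ht)

theorem IsSolution.comp_add_const {G : E →ₗ.[ℂ] E} {u : ℝ → E} (hu : IsSolution G u) (r : ℝ) :
    IsSolution G fun t => u (t + r) := fun t => by
  obtain ⟨h, hd⟩ := hu (t + r)
  exact ⟨h, hd.comp_add_const t r⟩

/-- Uniqueness for the evolution equation of an operator that is quasi-accretive together with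
its negative. -/
theorem IsSolution.eq {G G' : E →ₗ.[ℂ] E}
    (hGG' : ∀ x y, (x, y) ∈ G'.graph ↔ (x, -y) ∈ G.graph)
    (hG : IsQuasiMAccretive G) (hG' : IsQuasiMAccretive G') {u v : ℝ → E}
    (hu : IsSolution G u) (hv : IsSolution G v) {t₀ : ℝ} (h0 : u t₀ = v t₀) : u = v := by
  obtain ⟨ω, -, hacc⟩ := hG.accretive
  obtain ⟨ω', -, hacc'⟩ := hG'.accretive
  choose hud hu using hu
  choose hvd hv using hv
  set w' : ℝ → E := fun t => G ⟨u t, hud t⟩ - G ⟨v t, hvd t⟩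
  have hg : ∀ t, (u t - v t, w' t) ∈ G.graph := fun t =>
    G.graph.sub_mem (G.mem_graph ⟨u t, hud t⟩) (G.mem_graph ⟨v t, hvd t⟩)
  have hd : ∀ t, HasDerivAt (fun s => u s - v s) (-(w' t)) t := fun t =>
    ((hu t).sub (hv t)).congr_deriv (by simp only [w']; abel)
  funext t
  rw [← sub_eq_zero, ← norm_le_zero_iff]
  rcases le_total t₀ t with h | h
  · have := norm_le_exp_mul_of_re_inner_le (κ := ω) hd (fun s => by
      rw [inner_neg_right, Complex.neg_re]; linarith [hacc _ _ (hg s)]) h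
    simpa [h0] using this
  -- Before `t₀`, reverse time and use the accretivity of `G' = -G`.
  · have hd' : ∀ s, HasDerivAt (fun s => u (-s) - v (-s)) (w' (-s)) s := fun s => by
      have := (hd (-s)).scomp s (hasDerivAt_neg s)
      exact this.congr_deriv (by simp)
    have := norm_le_exp_mul_of_re_inner_le (κ := ω') hd' (fun s => by
      have h1 := hacc' _ (-(w' (-s))) ((hGG' _ _).2 (by rw [neg_neg]; exact hg (-s)))
      rw [inner_neg_right, Complex.neg_re] at h1
      linarith) (neg_le_neg h)
    simpa [h0] using this

/-- For `x` in the domain, both sides of the group law solve the equation in `s` and agree at `s =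
0`. Uniqueness thus covers all sign combinations, and density finishes. -/
theorem isSCGroup_glue [CompleteSpace E] {G G' : E →ₗ.[ℂ] E}
    (hGG' : ∀ x y, (x, y) ∈ G'.graph ↔ (x, -y) ∈ G.graph)
    (hG : IsQuasiMAccretive G) (hG' : IsQuasiMAccretive G') {Tp Tm : ℝ≥0 → E →L[ℂ] E}
    (hp : Generates G Tp) (hm : Generates G' Tm) : IsSCGroup (glue Tp Tm) := by
  have h0 : glue Tp Tm 0 = ContinuousLinearMap.id ℂ E := by
    simp [glue, hp.1.map_zero]
  refine ⟨h0, fun s t => ?_, fun x => ?_⟩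
  · refine ContinuousLinearMap.ext_on (s := (G.domain : Set E))
      (by simpa using hG.dense_domain) fun x hx => ?_
    have h1 := isSolution_glue hGG' hp hm hx
    obtain ⟨h2, -⟩ := h1 t
    have h3 := IsSolution.eq hGG' hG hG' (h1.comp_add_const t) (isSolution_glue hGG' hp hm h2)
      (t₀ := 0) (by simp [h0])
    exact congrFun h3 s
  · have h1 : Continuous fun t : ℝ => Tp t.toNNReal x :=
      (hp.1.continuous_orbit x).comp continuous_real_toNNReal
    have h2 : Continuous fun t : ℝ => Tm (-t).toNNReal x :=
      (hm.1.continuous_orbit x).comp (continuous_real_toNNReal.comp continuous_neg)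
    have h3 : (fun t => glue Tp Tm t x) =
        fun t => if 0 ≤ t then Tp t.toNNReal x else Tm (-t).toNNReal x := by
      funext t
      unfold glue
      split_ifs <;> rfl
    rw [h3]
    refine Continuous.if_le h1 h2 continuous_const continuous_id fun t ht => ?_
    rw [← ht]
    simp [hp.1.map_zero, hm.1.map_zero]

theorem existsUnique_isSolution [CompleteSpace E] {G G' : E →ₗ.[ℂ] E}
    (hGG' : ∀ x y, (x, y) ∈ G'.graph ↔ (x, -y) ∈ G.graph)
    (hG : IsQuasiMAccretive G) (hG' : IsQuasiMAccretive G') (t₀ : ℝ) (x : G.domain) :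
    ∃! u : ℝ → E, u t₀ = x ∧ IsSolution G u := by
  obtain ⟨Tp, hp⟩ := hG.exists_generates
  obtain ⟨Tm, hm⟩ := hG'.exists_generates
  have h1 := (isSolution_glue hGG' hp hm x.2).comp_add_const (-t₀)
  have h2 : glue Tp Tm (t₀ + -t₀) (x : E) = x := by simp [glue, hp.1.map_zero]
  exact ⟨_, ⟨h2, h1⟩, fun v hv => IsSolution.eq hGG' hG hG' hv.2 h1 (hv.1.trans h2.symm)⟩

theorem IsSolution.hasDerivAt_re_inner_self {G : E →ₗ.[ℂ] E} {u : ℝ → E} (hu : IsSolution G u)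
    (t : ℝ) (h : u t ∈ G.domain) :
    HasDerivAt (fun s : ℝ => (inner ℂ (u s) (u s)).re)
      (-2 * (inner ℂ (u t) (G ⟨u t, h⟩)).re) t := by
  obtain ⟨_, hd⟩ := hu t
  refine (AbstractWave.hasDerivAt_re_inner_self hd).congr_deriv ?_
  rw [inner_neg_right, Complex.neg_re]
  ring

end Evolution

/-! ### Geometry and completeness of the energy space -/

section EnergyGeometry

open Filter Topology EnergySpace

variable {X : Type*} [NormedAddCommGroup X] [InnerProductSpace ℂ X] [CompleteSpace X]
  {A : X →ₗ.[ℂ] X} (hA : IsStrictlyPositiveSA A)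

theorem sqrtOp_surjective (p : X) : ∃ x : (sqrtOp hA).domain, sqrtOp hA x = p := by
  obtain ⟨R, -, hR⟩ := hA.exists_inverse
  obtain ⟨z, -, hz⟩ := ((sqrtOp_spec hA).sq_eq (R p) p).1 ((hR _ _).2 rfl)
  obtain ⟨x, -, hx⟩ := (LinearPMap.mem_graph_iff _).1 hz
  exact ⟨x, hx⟩

/-- `A^{1/2}` is a self-adjoint bijection onto `X`, so its inverse is bounded. -/
theorem exists_norm_le_mul_norm_sqrtOp :
    ∃ k : ℝ, 0 ≤ k ∧ ∀ x : (sqrtOp hA).domain, ‖(x : X)‖ ≤ k * ‖sqrtOp hA x‖ := by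
  have hinj : ∀ x, (x, (0 : X)) ∈ (sqrtOp hA).graph → x = 0 := fun x hx => by
    obtain ⟨y, rfl, hy⟩ := (LinearPMap.mem_graph_iff _).1 hx
    rw [sqrtOp_injective hA y hy]; rfl
  have hsurj : ∀ y, ∃ x, (x, y) ∈ (sqrtOp hA).graph := fun y => by
    obtain ⟨x, rfl⟩ := sqrtOp_surjective hA y
    exact ⟨x, (sqrtOp hA).mem_graph x⟩
  obtain ⟨Q, -, hQ⟩ := exists_inverse (sqrtOp_spec hA).isSelfAdjoint hinj hsurj
  refine ⟨‖Q‖, norm_nonneg _, fun x => ?_⟩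
  conv_lhs => rw [(hQ _ _).1 ((sqrtOp hA).mem_graph x)]
  exact Q.le_opNorm _

/-- For `v` in `D(A)`, `A^{1/2}v` lies in `D(A^{1/2})`, so the second root can be moved across. -/
theorem inner_sqrtOp_sqrtOp {x : X} {y : X} (hxy : (x, y) ∈ A.graph) (v w : (sqrtOp hA).domain)
    (hv : (v : X) = x) : inner ℂ (sqrtOp hA v) (sqrtOp hA w) = inner ℂ y (w : X) := by
  obtain ⟨z, hz, hzy⟩ := ((sqrtOp_spec hA).sq_eq _ _).1 hxy
  have h1 : sqrtOp hA v = z :=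
    LinearPMap.mem_graph_snd_inj _ ((sqrtOp hA).mem_graph v) hz hv
  rw [h1]
  exact (inner_graph_symm (sqrtOp_spec hA).isSelfAdjoint hzy ((sqrtOp hA).mem_graph w)).symm

variable {hA}

theorem EnergySpace.norm_sq_eq (ξ : EnergySpace hA) :
    ‖ξ‖ ^ 2 = ‖sqrtOp hA (fst ξ)‖ ^ 2 + ‖snd ξ‖ ^ 2 := by
  rw [← re_inner_self_eq_norm_sq, inner_def, Complex.add_re, re_inner_self_eq_norm_sq,
    re_inner_self_eq_norm_sq]

theorem EnergySpace.norm_fst_le (ξ : EnergySpace hA) : ‖sqrtOp hA (fst ξ)‖ ≤ ‖ξ‖ :=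
  le_of_sq_le_sq (by rw [norm_sq_eq ξ]; linarith [sq_nonneg ‖snd ξ‖]) (norm_nonneg _)

theorem EnergySpace.norm_snd_le (ξ : EnergySpace hA) : ‖snd ξ‖ ≤ ‖ξ‖ :=
  le_of_sq_le_sq (by rw [norm_sq_eq ξ]; linarith [sq_nonneg ‖sqrtOp hA (fst ξ)‖]) (norm_nonneg _)

/-- `ξ ↦ (A^{1/2}ξ₁, ξ₂)` is isometric onto the Hilbert sum of two copies of `X`, because `A^{1/2}`
is onto. -/
instance EnergySpace.instCompleteSpace : CompleteSpace (EnergySpace hA) := by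
  refine Metric.complete_of_cauchySeq_tendsto fun u hu => ?_
  let p : EnergySpace hA →L[ℂ] X :=
    ((sqrtOp hA).toFun ∘ₗ fst).mkContinuous 1 fun ξ => by rw [one_mul]; exact norm_fst_le ξ
  let q : EnergySpace hA →L[ℂ] X :=
    LinearMap.mkContinuous snd 1 fun ξ => by rw [one_mul]; exact norm_snd_le ξ
  obtain ⟨a, ha⟩ := cauchySeq_tendsto_of_complete (p.uniformContinuous.comp_cauchySeq hu)
  obtain ⟨b, hb⟩ := cauchySeq_tendsto_of_complete (q.uniformContinuous.comp_cauchySeq hu)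
  obtain ⟨x, rfl⟩ := sqrtOp_surjective hA a
  refine ⟨mk x b, tendsto_iff_norm_sub_tendsto_zero.2 ?_⟩
  have h1 : ∀ n, ‖u n - mk x b‖ = √(‖p (u n) - sqrtOp hA x‖ ^ 2 + ‖q (u n) - b‖ ^ 2) := fun n => by
    have h2 := norm_sq_eq (u n - mk x b)
    rw [map_sub, map_sub, LinearPMap.map_sub] at h2
    rw [← Real.sqrt_sq (norm_nonneg (u n - mk x b)), h2]
    rfl
  simp_rw [h1]
  have h3 := ((tendsto_iff_norm_sub_tendsto_zero.1 ha).pow 2).add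
    ((tendsto_iff_norm_sub_tendsto_zero.1 hb).pow 2)
  simpa using h3.sqrt

end EnergyGeometry

/-! ### Neumann series perturbation -/

section Perturbation

/-- `F + P = (1 + PF⁻¹)F` with `‖PF⁻¹‖ ≤ q < 1`. No norm on `D` is needed. -/
theorem surjective_add_of_norm_le {D E : Type*} [AddCommGroup D] [Module ℂ D]
    [NormedAddCommGroup E] [NormedSpace ℂ E] [CompleteSpace E] {F P : D →ₗ[ℂ] E}
    (hF : Function.Bijective F) {q : ℝ} (hq0 : 0 ≤ q) (hq : q < 1)
    (hP : ∀ x, ‖P x‖ ≤ q * ‖F x‖) : Function.Surjective (F + P) := by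
  let e := LinearEquiv.ofBijective F hF
  let N : E →L[ℂ] E := (P ∘ₗ e.symm.toLinearMap).mkContinuous q fun y => by
    have := hP (e.symm y)
    rwa [show F (e.symm y) = y from e.apply_symm_apply y] at this
  have hN : ‖-N‖ < 1 := by
    rw [norm_neg]
    exact (LinearMap.mkContinuous_norm_le _ hq0 _).trans_lt hq
  obtain ⟨U, hU⟩ := isUnit_one_sub_of_norm_lt_one hN
  intro y
  refine ⟨e.symm ((↑U⁻¹ : E →L[ℂ] E) y), ?_⟩
  have h1 : ((U : E →L[ℂ] E) * (↑U⁻¹ : E →L[ℂ] E)) y = y := by rw [Units.mul_inv]; rfl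
  rw [hU, sub_neg_eq_add] at h1
  rw [LinearMap.add_apply, show F (e.symm _) = _ from e.apply_symm_apply _]
  exact h1

end Perturbation

/-! ### The free wave operator -/

section Wave

open Filter Topology EnergySpace

variable {X : Type*} [NormedAddCommGroup X] [InnerProductSpace ℂ X] [CompleteSpace X]
  {A : X →ₗ.[ℂ] X} (hA : IsStrictlyPositiveSA A)

/-- The free part `-i H` of `G₊`. -/
noncomputable def freeWave : domH hA →ₗ[ℂ] EnergySpace hA := (-Complex.I) • (opH hA).toFun

/-- The part `-i (B̂ + V)` of `G₊`. -/
noncomputable def dampingWave (B C : (sqrtOp hA).domain →ₗ[ℂ] X) : domH hA →ₗ[ℂ] EnergySpace hA :=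
  let b : domH hA →ₗ[ℂ] EnergySpace hA := (opBhat hA B).toFun
  (-Complex.I) • (b + opV hA C ∘ₗ (domH hA).subtype)

variable {hA}

theorem freeWave_apply (ξ : domH hA) : freeWave hA ξ = mk (-domSnd hA ξ) (A (domFst hA ξ)) := by
  have h : freeWave hA ξ =
      (-Complex.I) • mk (-Complex.I • domSnd hA ξ) (Complex.I • A (domFst hA ξ)) := rfl
  rw [h]
  ext1
  · rw [map_smul, fst_mk, fst_mk, smul_smul]; simp
  · rw [map_smul, snd_mk, snd_mk, smul_smul]; simp

theorem dampingWave_apply (B C : (sqrtOp hA).domain →ₗ[ℂ] X) (ξ : domH hA) :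
    dampingWave hA B C ξ =
      mk 0 (Complex.I • B (domSnd hA ξ) + C (fst (ξ : EnergySpace hA))) := by
  have h : dampingWave hA B C ξ = (-Complex.I) • (mk 0 (-B (domSnd hA ξ)) +
      mk 0 (Complex.I • C (fst (ξ : EnergySpace hA)))) := rfl
  rw [h]
  ext1
  · rw [map_smul, map_add, fst_mk, fst_mk, fst_mk]; simp
  · rw [map_smul, map_add, snd_mk, snd_mk, snd_mk, smul_add, smul_smul]; simp

theorem mem_graph_opGPlus {B C : (sqrtOp hA).domain →ₗ[ℂ] X} {ξ η : EnergySpace hA} :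
    (ξ, η) ∈ (opGPlus hA B C).graph ↔
      ∃ h : ξ ∈ domH hA, freeWave hA ⟨ξ, h⟩ + dampingWave hA B C ⟨ξ, h⟩ = η := by
  have key : ∀ (h : ξ ∈ domH hA) (h' : ξ ∈ (opGPlus hA B C).domain),
      opGPlus hA B C ⟨ξ, h'⟩ = freeWave hA ⟨ξ, h⟩ + dampingWave hA B C ⟨ξ, h⟩ := fun h h' => by
    have h1 : opGPlus hA B C ⟨ξ, h'⟩ = (-Complex.I) • (opV hA C ξ +
      (opH hA ⟨ξ, h⟩ + opBhat hA B ⟨ξ, h⟩)) := rfl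
    have h2 : freeWave hA ⟨ξ, h⟩ + dampingWave hA B C ⟨ξ, h⟩ = (-Complex.I) • opH hA ⟨ξ, h⟩ +
      (-Complex.I) • (opBhat hA B ⟨ξ, h⟩ + opV hA C ξ) := rfl
    rw [h1, h2, ← smul_add]
    congr 1; abel
  constructor
  · intro h
    obtain ⟨⟨ζ, hζ⟩, rfl, rfl⟩ := (LinearPMap.mem_graph_iff _).1 h
    exact ⟨hζ.1, (key hζ.1 hζ).symm⟩
  · rintro ⟨h, rfl⟩
    -- The domain of the sum is the intersection of `domH` with itself.
    have h' : ξ ∈ (opGPlus hA B C).domain := ⟨h, h⟩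
    rw [← key h h']
    exact LinearPMap.mem_graph _ ⟨ξ, h'⟩

theorem mem_graph_opGMinus {B C : (sqrtOp hA).domain →ₗ[ℂ] X} (ξ η : EnergySpace hA) :
    (ξ, η) ∈ (opGMinus hA B C).graph ↔ (ξ, -η) ∈ (opGPlus hA B C).graph := by
  have key : ∀ (ζ : EnergySpace hA) (h : ζ ∈ (opGPlus hA B C).domain)
      (h' : ζ ∈ (opGMinus hA B C).domain),
      opGMinus hA B C ⟨ζ, h'⟩ = -opGPlus hA B C ⟨ζ, h⟩ := fun ζ h h' => by
    have h1 : opGPlus hA B C ⟨ζ, h⟩ = (-Complex.I) • (opV hA C ζ +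
      (opH hA ⟨ζ, h.1⟩ + opBhat hA B ⟨ζ, h.1⟩)) := rfl
    have h2 : opGMinus hA B C ⟨ζ, h'⟩ = Complex.I • (opV hA C ζ +
      (opH hA ⟨ζ, h.1⟩ + opBhat hA B ⟨ζ, h.1⟩)) := rfl
    rw [h1, h2, neg_smul, neg_neg]
  rw [LinearPMap.mem_graph_iff, LinearPMap.mem_graph_iff]
  constructor
  · rintro ⟨⟨ζ, hζ⟩, rfl, rfl⟩
    exact ⟨⟨ζ, hζ⟩, rfl, by rw [key ζ hζ hζ, neg_neg]⟩
  · rintro ⟨⟨ζ, hζ⟩, rfl, h2⟩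
    exact ⟨⟨ζ, hζ⟩, rfl, by rw [key ζ hζ hζ, h2, neg_neg]⟩

/-- The two terms are `-⟨Aξ₁|ξ₂⟩` and its negated conjugate `⟨ξ₂|Aξ₁⟩`, whose real parts cancel. -/
theorem re_inner_freeWave (ξ : domH hA) :
    (inner ℂ (ξ : EnergySpace hA) (freeWave hA ξ)).re = 0 := by
  rw [freeWave_apply, inner_def, fst_mk, snd_mk, LinearPMap.map_neg, inner_neg_right,
    inner_sqrtOp_sqrtOp hA (A.mem_graph (domFst hA ξ)) (fst (ξ : EnergySpace hA)) _ rfl,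
    Complex.add_re, Complex.neg_re]
  have h : (inner ℂ (snd (ξ : EnergySpace hA)) (A (domFst hA ξ))).re =
    (inner ℂ (A (domFst hA ξ)) (snd (ξ : EnergySpace hA))).re := inner_re_symm (𝕜 := ℂ) _ _
  rw [h]
  exact neg_add_cancel _

theorem norm_sq_smul_add_freeWave (l : ℝ) (ξ : domH hA) :
    ‖(l : ℂ) • (ξ : EnergySpace hA) + freeWave hA ξ‖ ^ 2 =
      (|l| * ‖ξ‖) ^ 2 + ‖freeWave hA ξ‖ ^ 2 := by
  rw [norm_add_sq (𝕜 := ℂ), inner_smul_left, Complex.conj_ofReal]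
  have : RCLike.re ((l : ℂ) * inner ℂ (ξ : EnergySpace hA) (freeWave hA ξ)) = 0 := by
    change ((l : ℂ) * _).re = 0
    rw [Complex.re_ofReal_mul, re_inner_freeWave, mul_zero]
  rw [this, norm_smul, Complex.norm_real, Real.norm_eq_abs]
  simp

/-- Injectivity is Pythagoras. For surjectivity, eliminating `x₂ = lx₁ - η₁` leaves `(A + l²)x₁ = η₂
+ lη₁`. With `x₁ = A⁻¹y` this is `(1 + l²A⁻¹)y = η₂ + lη₁`, solvable since `A⁻¹ ≥ 0`. -/
theorem bijective_smul_add_freeWave {l : ℝ} (hl : l ≠ 0) :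
    Function.Bijective ((l : ℂ) • (domH hA).subtype + freeWave hA) := by
  constructor
  · refine (injective_iff_map_eq_zero _).2 fun ξ hξ => ?_
    have h1 := norm_sq_smul_add_freeWave l ξ
    have h2 : (l : ℂ) • (ξ : EnergySpace hA) + freeWave hA ξ = 0 := hξ
    rw [h2, norm_zero] at h1
    have h3 : |l| * ‖ξ‖ = 0 := by
      refine (pow_eq_zero_iff two_ne_zero).1 (le_antisymm ?_ (sq_nonneg _))
      nlinarith [sq_nonneg ‖freeWave hA ξ‖]
    simpa [hl] using h3
  · intro η
    obtain ⟨R, hR0, hR⟩ := hA.exists_inverse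
    have hu : IsUnit (1 + ((l ^ 2 : ℝ) : ℂ) • R) := by
      have h1 : (0 : X →L[ℂ] X) ≤ (l ^ 2) • R := smul_nonneg (sq_nonneg l) hR0
      rw [Complex.coe_smul]
      exact CStarAlgebra.isUnit_of_le 1 (le_add_of_nonneg_right h1)
    obtain ⟨U, hU⟩ := hu
    set g := snd η + (l : ℂ) • (fst η : X)
    set y := (↑U⁻¹ : X →L[ℂ] X) g
    have hy : y + ((l ^ 2 : ℝ) : ℂ) • R y = g := by
      have h1 : ((U : X →L[ℂ] X) * (↑U⁻¹ : X →L[ℂ] X)) g = g := by rw [Units.mul_inv]; rfl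
      rwa [hU] at h1
    have hRy : (R y, y) ∈ A.graph := (hR _ _).2 rfl
    have hRyA : R y ∈ A.domain := LinearPMap.mem_domain_of_mem_graph hRy
    let x₁ : (sqrtOp hA).domain := ⟨R y, mem_sqrtOp_domain hA hRyA⟩
    let x₂ : (sqrtOp hA).domain := (l : ℂ) • x₁ - fst η
    refine ⟨⟨mk x₁ x₂, hRyA, x₂.2⟩, ?_⟩
    have h1 : A ⟨R y, hRyA⟩ = y := LinearPMap.mem_graph_snd_inj _ (A.mem_graph _) hRy rfl
    change (l : ℂ) • mk x₁ (x₂ : X) + freeWave hA _ = η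
    rw [freeWave_apply]
    ext1
    · rw [map_add, map_smul, fst_mk, fst_mk]
      change (l : ℂ) • x₁ + -((l : ℂ) • x₁ - fst η) = fst η
      abel
    · rw [map_add, map_smul, snd_mk, snd_mk]
      change (l : ℂ) • ((l : ℂ) • R y - (fst η : X)) + A ⟨R y, hRyA⟩ = snd η
      have h2 : snd η = y + ((l ^ 2 : ℝ) : ℂ) • R y - (l : ℂ) • (fst η : X) := by
        rw [hy]; simp [g]
      rw [h1, h2, smul_sub, smul_smul]
      push_cast
      rw [pow_two]
      abel

end Wave

/-! ### Quasi-`m`-accretivity of `G₊` and `G₋` -/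

section Generator

open EnergySpace

variable {X : Type*} [NormedAddCommGroup X] [InnerProductSpace ℂ X] [CompleteSpace X]
  {A : X →ₗ.[ℂ] X} {hA : IsStrictlyPositiveSA A} {B C : (sqrtOp hA).domain →ₗ[ℂ] X}

theorem exists_norm_le_mul_norm_energySpace (hC : ∃ c d : ℝ, ∀ ξ : (sqrtOp hA).domain,
      ‖C ξ‖ ^ 2 ≤ c ^ 2 * ‖sqrtOp hA ξ‖ ^ 2 + d ^ 2 * ‖(ξ : X)‖ ^ 2) :
    ∃ M : ℝ, 0 ≤ M ∧ ∀ ξ : EnergySpace hA, ‖C (fst ξ)‖ ≤ M * ‖ξ‖ := by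
  obtain ⟨c, d, h⟩ := hC
  obtain ⟨k, hk, hS⟩ := exists_norm_le_mul_norm_sqrtOp hA
  refine ⟨√(c ^ 2 + d ^ 2 * k ^ 2), Real.sqrt_nonneg _, fun ξ => ?_⟩
  refine le_of_sq_le_sq ?_ (by positivity)
  rw [mul_pow, Real.sq_sqrt (by positivity)]
  have h1 : ‖(fst ξ : X)‖ ^ 2 ≤ (k * ‖ξ‖) ^ 2 := by
    have := (hS (fst ξ)).trans (mul_le_mul_of_nonneg_left (EnergySpace.norm_fst_le ξ) hk)
    exact pow_le_pow_left₀ (norm_nonneg _) this 2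
  have h2 : ‖sqrtOp hA (fst ξ)‖ ^ 2 ≤ ‖ξ‖ ^ 2 :=
    pow_le_pow_left₀ (norm_nonneg _) (EnergySpace.norm_fst_le ξ) 2
  nlinarith [h (fst ξ), mul_le_mul_of_nonneg_left h1 (sq_nonneg d),
    mul_le_mul_of_nonneg_left h2 (sq_nonneg c)]

/-- For symmetric `B`, `⟨ξ|Bξ⟩` is real and the factor `i` kills the real part; for bounded `B`, use
Cauchy-Schwarz. The absolute value serves both signs of the generator. -/
theorem exists_abs_re_inner_I_smul_le
    (hB : (∀ ξ η : (sqrtOp hA).domain, inner ℂ (B ξ) (η : X) = inner ℂ (ξ : X) (B η)) ∨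
      ∃ M : ℝ, ∀ ξ : (sqrtOp hA).domain, ‖B ξ‖ ≤ M * ‖(ξ : X)‖) :
    ∃ M : ℝ, 0 ≤ M ∧ ∀ ξ : (sqrtOp hA).domain,
      |(inner ℂ (ξ : X) (Complex.I • B ξ)).re| ≤ M * ‖(ξ : X)‖ ^ 2 := by
  rcases hB with hB | ⟨M, hM⟩
  · refine ⟨0, le_rfl, fun ξ => ?_⟩
    have h1 : (inner ℂ (ξ : X) (B ξ)).im = 0 := by
      refine Complex.conj_eq_iff_im.1 ?_
      rw [inner_conj_symm, hB]
    rw [inner_smul_right, Complex.I_mul_re, h1]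
    simp
  · refine ⟨|M|, abs_nonneg _, fun ξ => ?_⟩
    have h1 : ‖inner ℂ (ξ : X) (Complex.I • B ξ)‖ ≤ ‖(ξ : X)‖ * ‖Complex.I • B ξ‖ :=
      norm_inner_le_norm _ _
    rw [norm_smul, Complex.norm_I, one_mul] at h1
    refine (Complex.abs_re_le_norm _).trans (h1.trans ?_)
    have h2 : ‖B ξ‖ ≤ |M| * ‖(ξ : X)‖ :=
      (hM ξ).trans (mul_le_mul_of_nonneg_right (le_abs_self M) (norm_nonneg _))
    nlinarith [norm_nonneg (ξ : X)]

theorem exists_abs_re_inner_opGPlus_le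
    (hC : ∃ c d : ℝ, ∀ ξ : (sqrtOp hA).domain,
      ‖C ξ‖ ^ 2 ≤ c ^ 2 * ‖sqrtOp hA ξ‖ ^ 2 + d ^ 2 * ‖(ξ : X)‖ ^ 2)
    (hB : (∀ ξ η : (sqrtOp hA).domain, inner ℂ (B ξ) (η : X) = inner ℂ (ξ : X) (B η)) ∨
      ∃ M : ℝ, ∀ ξ : (sqrtOp hA).domain, ‖B ξ‖ ≤ M * ‖(ξ : X)‖) :
    ∃ ω : ℝ, 0 ≤ ω ∧ ∀ ξ η, (ξ, η) ∈ (opGPlus hA B C).graph →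
      |(inner ℂ ξ η).re| ≤ ω * ‖ξ‖ ^ 2 := by
  obtain ⟨M, hM0, hM⟩ := exists_norm_le_mul_norm_energySpace hC
  obtain ⟨N, hN0, hN⟩ := exists_abs_re_inner_I_smul_le hB
  refine ⟨N + M, by positivity, fun ξ η h => ?_⟩
  obtain ⟨hξ, rfl⟩ := mem_graph_opGPlus.1 h
  have h1 : (inner ℂ ξ (freeWave hA ⟨ξ, hξ⟩)).re = 0 := re_inner_freeWave ⟨ξ, hξ⟩
  rw [inner_add_right, Complex.add_re, h1, zero_add, dampingWave_apply, inner_def, fst_mk,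
    snd_mk, LinearPMap.map_zero, inner_zero_right, zero_add, inner_add_right, Complex.add_re]
  have h2 := hN (domSnd hA ⟨ξ, hξ⟩)
  have h3 : |(inner ℂ (snd ξ) (C (fst ξ))).re| ≤ ‖snd ξ‖ * ‖C (fst ξ)‖ :=
    (Complex.abs_re_le_norm _).trans (norm_inner_le_norm _ _)
  have h4 := EnergySpace.norm_snd_le ξ
  refine (abs_add_le _ _).trans ?_
  rw [add_mul]
  refine add_le_add (h2.trans ?_) (h3.trans ?_)
  · exact mul_le_mul_of_nonneg_left (pow_le_pow_left₀ (norm_nonneg _) h4 2) hN0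
  · calc ‖snd ξ‖ * ‖C (fst ξ)‖ ≤ ‖ξ‖ * (M * ‖ξ‖) :=
          mul_le_mul h4 (hM ξ) (norm_nonneg _) (norm_nonneg _)
      _ = M * ‖ξ‖ ^ 2 := by ring

theorem exists_opGPlus_surjective
    (hB : ∃ a b : ℝ, 0 ≤ a ∧ a < 1 ∧ ∀ ξ : (sqrtOp hA).domain,
      ‖B ξ‖ ^ 2 ≤ a ^ 2 * ‖sqrtOp hA ξ‖ ^ 2 + b ^ 2 * ‖(ξ : X)‖ ^ 2)
    (hC : ∃ c d : ℝ, ∀ ξ : (sqrtOp hA).domain,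
      ‖C ξ‖ ^ 2 ≤ c ^ 2 * ‖sqrtOp hA ξ‖ ^ 2 + d ^ 2 * ‖(ξ : X)‖ ^ 2) :
    ∃ l₀ : ℝ, ∀ l : ℝ, l₀ < |l| → ∀ y, ∃ x z, (x, z) ∈ (opGPlus hA B C).graph ∧
      (l : ℂ) • x + z = y := by
  obtain ⟨a, b, ha0, ha1, hB⟩ := hB
  obtain ⟨M, hM0, hM⟩ := exists_norm_le_mul_norm_energySpace hC
  have ha : 0 < 1 - a := sub_pos.2 ha1
  -- Exactly the threshold at which `a + (|b| + M)/|l|` drops below 1.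
  refine ⟨(|b| + M) / (1 - a), fun l hl y => ?_⟩
  have hl0 : 0 < |l| := lt_of_le_of_lt (by positivity) hl
  have hq : a + (|b| + M) / |l| < 1 := by
    rw [div_lt_iff₀ ha, mul_comm, ← div_lt_iff₀ hl0] at hl
    linarith
  suffices h : ∀ ξ : domH hA, ‖dampingWave hA B C ξ‖ ≤
      (a + (|b| + M) / |l|) * ‖((l : ℂ) • (domH hA).subtype + freeWave hA) ξ‖ by
    obtain ⟨ξ, hξ⟩ := surjective_add_of_norm_le (bijective_smul_add_freeWave (hA := hA)
      (abs_pos.1 hl0)) (by positivity) hq h y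
    exact ⟨ξ, _, mem_graph_opGPlus.2 ⟨ξ.2, rfl⟩, by rw [← hξ, ← add_assoc]; rfl⟩
  intro ξ
  change _ ≤ _ * ‖(l : ℂ) • (ξ : EnergySpace hA) + freeWave hA ξ‖
  have h1 := norm_sq_smul_add_freeWave l ξ
  set w := ‖(l : ℂ) • (ξ : EnergySpace hA) + freeWave hA ξ‖
  have hw0 : 0 ≤ w := norm_nonneg _
  have h2 : ‖freeWave hA ξ‖ ≤ w :=
    le_of_sq_le_sq (by linarith [sq_nonneg (|l| * ‖ξ‖)]) hw0
  have h3 : |l| * ‖ξ‖ ≤ w :=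
    le_of_sq_le_sq (by linarith [sq_nonneg ‖freeWave hA ξ‖]) hw0
  have h3' : ‖ξ‖ ≤ w / |l| := by rwa [le_div_iff₀ hl0, mul_comm]
  -- The first component of the free part is `-ξ₂`, measured in `Y` through `A^{1/2}`; so the
  -- relative bound `a` of `B` passes unchanged to the free operator.
  have h4 : ‖sqrtOp hA (domSnd hA ξ)‖ ≤ ‖freeWave hA ξ‖ := by
    have := EnergySpace.norm_fst_le (freeWave hA ξ)
    rwa [freeWave_apply, fst_mk, LinearPMap.map_neg, norm_neg, ← freeWave_apply] at this
  have h5 : ‖B (domSnd hA ξ)‖ ≤ a * w + |b| * ‖ξ‖ := by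
    refine le_of_sq_le_sq ((hB _).trans ?_) (by positivity)
    have h6 : a ^ 2 * ‖sqrtOp hA (domSnd hA ξ)‖ ^ 2 ≤ a ^ 2 * w ^ 2 :=
      mul_le_mul_of_nonneg_left (pow_le_pow_left₀ (norm_nonneg _) (h4.trans h2) 2) (sq_nonneg a)
    have h7 : b ^ 2 * ‖(domSnd hA ξ : X)‖ ^ 2 ≤ |b| ^ 2 * ‖ξ‖ ^ 2 := by
      rw [sq_abs]
      exact mul_le_mul_of_nonneg_left
        (pow_le_pow_left₀ (norm_nonneg _) (EnergySpace.norm_snd_le (ξ : EnergySpace hA)) 2)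
        (sq_nonneg b)
    have h8 : 0 ≤ (a * w) * (|b| * ‖ξ‖) := by positivity
    nlinarith
  have h9 : ‖dampingWave hA B C ξ‖ ≤ ‖B (domSnd hA ξ)‖ + ‖C (fst (ξ : EnergySpace hA))‖ := by
    refine le_of_sq_le_sq ?_ (by positivity)
    rw [norm_sq_eq, dampingWave_apply, fst_mk, snd_mk, LinearPMap.map_zero, norm_zero,
      zero_pow two_ne_zero, zero_add]
    refine pow_le_pow_left₀ (norm_nonneg _) ((norm_add_le _ _).trans_eq ?_) 2
    rw [norm_smul, Complex.norm_I, one_mul]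
  calc ‖dampingWave hA B C ξ‖ ≤ (a * w + |b| * ‖ξ‖) + M * ‖ξ‖ :=
        h9.trans (add_le_add h5 (hM ξ))
    _ = a * w + (|b| + M) * ‖ξ‖ := by ring
    _ ≤ a * w + (|b| + M) * (w / |l|) := by gcongr
    _ = _ := by ring

theorem isQuasiMAccretive_opGPlus
    (hB : ∃ a b : ℝ, 0 ≤ a ∧ a < 1 ∧ ∀ ξ : (sqrtOp hA).domain,
      ‖B ξ‖ ^ 2 ≤ a ^ 2 * ‖sqrtOp hA ξ‖ ^ 2 + b ^ 2 * ‖(ξ : X)‖ ^ 2)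
    (hC : ∃ c d : ℝ, ∀ ξ : (sqrtOp hA).domain,
      ‖C ξ‖ ^ 2 ≤ c ^ 2 * ‖sqrtOp hA ξ‖ ^ 2 + d ^ 2 * ‖(ξ : X)‖ ^ 2)
    (hB' : (∀ ξ η : (sqrtOp hA).domain, inner ℂ (B ξ) (η : X) = inner ℂ (ξ : X) (B η)) ∨
      ∃ M : ℝ, ∀ ξ : (sqrtOp hA).domain, ‖B ξ‖ ≤ M * ‖(ξ : X)‖) :
    IsQuasiMAccretive (opGPlus hA B C) := by
  obtain ⟨ω, hω, hacc⟩ := exists_abs_re_inner_opGPlus_le hC hB'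
  obtain ⟨l₀, hl₀⟩ := exists_opGPlus_surjective hB hC
  refine ⟨⟨ω, hω, fun ξ η h => ?_⟩, l₀, fun l hl => hl₀ l (hl.trans_le (le_abs_self l))⟩
  rw [neg_mul]
  exact (abs_le.1 (hacc ξ η h)).1

theorem isQuasiMAccretive_opGMinus
    (hB : ∃ a b : ℝ, 0 ≤ a ∧ a < 1 ∧ ∀ ξ : (sqrtOp hA).domain,
      ‖B ξ‖ ^ 2 ≤ a ^ 2 * ‖sqrtOp hA ξ‖ ^ 2 + b ^ 2 * ‖(ξ : X)‖ ^ 2)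
    (hC : ∃ c d : ℝ, ∀ ξ : (sqrtOp hA).domain,
      ‖C ξ‖ ^ 2 ≤ c ^ 2 * ‖sqrtOp hA ξ‖ ^ 2 + d ^ 2 * ‖(ξ : X)‖ ^ 2)
    (hB' : (∀ ξ η : (sqrtOp hA).domain, inner ℂ (B ξ) (η : X) = inner ℂ (ξ : X) (B η)) ∨
      ∃ M : ℝ, ∀ ξ : (sqrtOp hA).domain, ‖B ξ‖ ≤ M * ‖(ξ : X)‖) :
    IsQuasiMAccretive (opGMinus hA B C) := by
  obtain ⟨ω, hω, hacc⟩ := exists_abs_re_inner_opGPlus_le hC hB'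
  obtain ⟨l₀, hl₀⟩ := exists_opGPlus_surjective hB hC
  refine ⟨⟨ω, hω, fun ξ η h => ?_⟩, l₀, fun l hl y => ?_⟩
  · have h1 := (abs_le.1 (hacc ξ (-η) ((mem_graph_opGMinus _ _).1 h))).2
    rw [inner_neg_right, Complex.neg_re] at h1
    linarith
  -- `(l + G₋)x = y` is `(-l + G₊)x = -y`, hence the need for negative `l` above.
  · obtain ⟨x, z, hxz, h⟩ := hl₀ (-l) (hl.trans_le (by rw [abs_neg]; exact le_abs_self l)) (-y)
    refine ⟨x, -z, (mem_graph_opGMinus _ _).2 (by rwa [neg_neg]), ?_⟩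
    rw [← neg_neg y, ← h]
    push_cast
    rw [neg_smul]; abel

end Generator

end AbstractWave

theorem corollary9 {X : Type*} [NormedAddCommGroup X] [InnerProductSpace ℂ X] [CompleteSpace X]
    [Nontrivial X]
    (A : X →ₗ.[ℂ] X) (hA : IsStrictlyPositiveSA A)
    (B C : (sqrtOp hA).domain →ₗ[ℂ] X)
    (hB : ∃ a b : ℝ, 0 ≤ a ∧ a < 1 ∧ ∀ ξ : (sqrtOp hA).domain,
      ‖B ξ‖ ^ 2 ≤ a ^ 2 * ‖sqrtOp hA ξ‖ ^ 2 + b ^ 2 * ‖(ξ : X)‖ ^ 2)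
    (hC : ∃ c d : ℝ, ∀ ξ : (sqrtOp hA).domain,
      ‖C ξ‖ ^ 2 ≤ c ^ 2 * ‖sqrtOp hA ξ‖ ^ 2 + d ^ 2 * ‖(ξ : X)‖ ^ 2)
    (hB' : (∀ ξ η : (sqrtOp hA).domain, inner ℂ (B ξ) (η : X) = inner ℂ (ξ : X) (B η)) ∨
      ∃ M : ℝ, ∀ ξ : (sqrtOp hA).domain, ‖B ξ‖ ≤ M * ‖(ξ : X)‖) :
    ((∃ Tp : ℝ≥0 → EnergySpace hA →L[ℂ] EnergySpace hA, Generates (opGPlus hA B C) Tp) ∧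
      (∃ Tm : ℝ≥0 → EnergySpace hA →L[ℂ] EnergySpace hA, Generates (opGMinus hA B C) Tm) ∧
      ∀ Tp Tm : ℝ≥0 → EnergySpace hA →L[ℂ] EnergySpace hA,
        Generates (opGPlus hA B C) Tp → Generates (opGMinus hA B C) Tm →
          IsSCGroup (glue Tp Tm)) ∧
    ∀ (t₀ : ℝ) (ξ : (opGPlus hA B C).domain),
      (∃! u : ℝ → EnergySpace hA, u t₀ = ξ ∧ IsSolution (opGPlus hA B C) u) ∧
      ∀ u : ℝ → EnergySpace hA, u t₀ = ξ → IsSolution (opGPlus hA B C) u →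
        ∀ (t : ℝ) (h : u t ∈ (opGPlus hA B C).domain),
          HasDerivAt (fun s : ℝ => (inner ℂ (u s) (u s)).re)
            (-2 * (inner ℂ (u t) (opGPlus hA B C ⟨u t, h⟩)).re) t := by
  have hG := isQuasiMAccretive_opGPlus hB hC hB'
  have hG' := isQuasiMAccretive_opGMinus hB hC hB'
  exact ⟨⟨hG.exists_generates, hG'.exists_generates, fun _ _ hp hm =>
      isSCGroup_glue mem_graph_opGMinus hG hG' hp hm⟩,
    fun t₀ ξ => ⟨existsUnique_isSolution mem_graph_opGMinus hG hG' t₀ ξ,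
      fun _ _ hu t h => hu.hasDerivAt_re_inner_self t h⟩⟩
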